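/- Let $C$ be a unital C*-algebra and $\alpha:C\to C$ a unital *-homomorphism. A left covariant contractive (resp. isometric) pair $(\pi,V)$ consists of a (possibly degenerate) *-representation $\pi$ of $C$ on a Hilbert space $H$ and a contraction (resp. an isometry) $V\in B(H)$ such that $\pi(c)V=V\pi(\alpha(c))$ for all $c\in C$. Let $\ell^1(\mathbb Z_+,C,\alpha)_l$ be the Banach algebra of absolutely summable series $F=\sum_{n\ge 0}\delta_n\otimes c_n$ ($c_n\in C$) with norm $\sum_n\|c_n\|$ and multiplication determined by $(\delta_n\otimes c)(\delta_m\otimes y)=\delta_{n+m}\otimes\alpha^m(c)y$. Each such pair gives the contractive representation $(V\times\pi)(F)=\sum_n V^n\pi(c_n)$ of this algebra; let $C^*(\pi,V)$ denote the C*-algebra generated by the range of $V\times\pi$. Let $\mathfrak A(C,\alpha,\mathrm{contr})_l$ (resp. $\mathfrak A(C,\alpha,\mathrm{is})_l$) be the enveloping operator algebra of $\ell^1(\mathbb Z_+,C,\alpha)_l$ with respect to the representations $V\times\pi$, where $(\pi,V)$ ranges over all left covariant contractive (resp. isometric) pairs; that is, the completion of $\ell^1(\mathbb Z_+,C,\alpha)_l/\ker\omega_1$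 with matrix norms induced by $\omega_\nu([F_{ij}])=\sup_{(\pi,V)}\|[(V\times\pi)(F_{ij})]\|_{B(H^\nu)}$, $\nu\ge1$. Let $(\pi_u,V_u)$ be the direct sum of all left covariant isometric pairs. (Here and in the suprema above, Hilbert spaces range over a fixed set-theoretic universe, so that the collections are sets; it is assumed to contain the space $H_0$ below.) Let $(H_0,\pi)$ be any faithful representation of $C$. On $H_0\otimes\ell^2(\mathbb Z_+)$ put $\widetilde\pi(c)=\mathrm{diag}\{\pi(\alpha^n(c)):n\in\mathbb Z_+\}$ and $S=1_{H_0}\otimes s$, where $s$ is the unilateral shift; $(\widetilde\pi,S)$ is a left covariant isometric pair. **Theorem.** (1) There is a unique *-homomorphism $\Phi:C^*(\pi_u,V_u)\to C^*(\widetilde\pi,S)$ with $\Phi((V_u\times\pi_u)(F))=(S\times\widetilde\pi)(F)$ for all $F\in\ell^1(\mathbb Z_+,C,\alpha)_l$. It is surjective and injective, hence a *-isomorphism. (2) The semicrossed products $\mathfrak A(C,\alpha,\mathrm{contr})_l$ and $\mathfrak A(C,\alpha,\mathrm{is})_l$ are completely isometrically isomorphic, by an algebra isomorphism that fixes the image of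 $\ell^1(\mathbb Z_+,C,\alpha)_l$. Each of them is completely isometrically isomorphic to the closure in $C^*(\widetilde\pi,S)$ of the polynomials $\sum_{n=0}^k S^n\widetilde\pi(c_n)$, $c_n\in C$, $k\in\mathbb Z_+$, by an isomorphism that sends the image of $F$ to $(S\times\widetilde\pi)(F)$ for every $F\in\ell^1(\mathbb Z_+,C,\alpha)_l$. -/

import Mathlib

open scoped ENNReal

universe u w

noncomputable section

namespace Semicrossed

/-! ## The Banach algebra `ℓ¹(ℤ₊, C, α)_l` -/

section L1

variable {C : Type u} [CStarAlgebra C]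

/-- The Banach algebra `ℓ¹(ℤ₊, C, α)_l`: absolutely summable sequences `F = ∑ δₙ ⊗ F n` in `C`,
with the norm `|F|₁ = ∑ ‖F n‖` and the twisted convolution determined by
`(δₙ ⊗ c) * (δₘ ⊗ y) = δₙ₊ₘ ⊗ (αᵐ(c) y)`. -/
def L1 (_α : C →⋆ₐ[ℂ] C) : Type u := lp (fun _ : ℕ => C) 1

variable {α : C →⋆ₐ[ℂ] C}

instance : NormedAddCommGroup (L1 α) :=
  inferInstanceAs (NormedAddCommGroup (lp (fun _ : ℕ => C) 1))

instance : NormedSpace ℂ (L1 α) :=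
  inferInstanceAs (NormedSpace ℂ (lp (fun _ : ℕ => C) 1))

instance : CompleteSpace (L1 α) :=
  inferInstanceAs (CompleteSpace (lp (fun _ : ℕ => C) 1))

/-- `F` as an element of the space `lp`. -/
def L1.toLp (F : L1 α) : lp (fun _ : ℕ => C) 1 := F

instance : CoeFun (L1 α) (fun _ => ℕ → C) := ⟨fun F n => F.toLp n⟩

theorem L1.ext {F G : L1 α} (h : ∀ n, F n = G n) : F = G :=
  lp.ext (funext h)

@[simp] theorem L1.add_apply (F G : L1 α) (n : ℕ) : (F + G) n = F n + G n := rfl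
@[simp] theorem L1.zero_apply (n : ℕ) : (0 : L1 α) n = 0 := rfl
@[simp] theorem L1.smul_apply (z : ℂ) (F : L1 α) (n : ℕ) : (z • F) n = z • F n := rfl

theorem L1.summable_norm (F : L1 α) : Summable fun n => ‖F n‖ := by
  have h := (lp.memℓp F.toLp).summable (by simp)
  simpa using h

theorem L1.norm_eq (F : L1 α) : ‖F‖ = ∑' n, ‖F n‖ := by
  have h := lp.norm_eq_tsum_rpow (p := 1) (by simp) F.toLp
  simp only [ENNReal.toReal_one, Real.rpow_one, div_one] at h
  exact h

/-- An absolutely summable sequence as an element of `ℓ¹(ℤ₊, C, α)_l`. -/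
def L1.mk (α : C →⋆ₐ[ℂ] C) (f : ℕ → C) (hf : Summable fun n => ‖f n‖) : L1 α :=
  (⟨f, memℓp_gen (by simpa using hf)⟩ : lp (fun _ : ℕ => C) 1)

@[simp] theorem L1.mk_apply (f : ℕ → C) (hf : Summable fun n => ‖f n‖) (n : ℕ) :
    L1.mk α f hf n = f n := rfl

theorem norm_pow_apply_le (α : C →⋆ₐ[ℂ] C) (n : ℕ) (c : C) : ‖(α ^ n) c‖ ≤ ‖c‖ :=
  NonUnitalStarAlgHom.norm_apply_le (α ^ n) c

theorem pow_add_apply (α : C →⋆ₐ[ℂ] C) (m n : ℕ) (c : C) :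
    (α ^ (m + n)) c = (α ^ m) ((α ^ n) c) := by
  rw [pow_add]; rfl

theorem L1.norm_conv_le (F G : L1 α) (k : ℕ) :
    ‖∑ p ∈ Finset.HasAntidiagonal.antidiagonal k, (α ^ p.2) (F p.1) * G p.2‖ ≤
      ∑ p ∈ Finset.HasAntidiagonal.antidiagonal k, ‖F p.1‖ * ‖G p.2‖ :=
  (norm_sum_le _ _).trans <| Finset.sum_le_sum fun _ _ =>
    (norm_mul_le _ _).trans <|
      mul_le_mul_of_nonneg_right (norm_pow_apply_le α _ _) (norm_nonneg _)

theorem pow_zero_apply (α : C →⋆ₐ[ℂ] C) (c : C) : (α ^ 0) c = c := by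
  rw [pow_zero]; rfl

theorem L1.summable_cauchy (F G : L1 α) :
    Summable fun k => ∑ p ∈ Finset.HasAntidiagonal.antidiagonal k, ‖F p.1‖ * ‖G p.2‖ := by
  have hF : Summable fun n => ‖F n‖ := F.summable_norm
  have hG : Summable fun n => ‖G n‖ := G.summable_norm
  have h : Summable fun x : ℕ × ℕ => ‖F x.1‖ * ‖G x.2‖ :=
    Summable.mul_of_nonneg hF hG (fun _ => norm_nonneg _) fun _ => norm_nonneg _
  exact summable_sum_mul_antidiagonal_of_summable_mul (f := fun n => ‖F n‖) (g := fun n => ‖G n‖) h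

instance : Mul (L1 α) where
  mul F G := L1.mk α (fun k => ∑ p ∈ Finset.HasAntidiagonal.antidiagonal k, (α ^ p.2) (F p.1) * G p.2)
    ((L1.summable_cauchy F G).of_nonneg_of_le (fun _ => norm_nonneg _) (L1.norm_conv_le F G))

theorem L1.mul_apply (F G : L1 α) (k : ℕ) :
    (F * G) k = ∑ p ∈ Finset.HasAntidiagonal.antidiagonal k, (α ^ p.2) (F p.1) * G p.2 := rfl

/-- The element `δₙ ⊗ c`. -/
def L1.single (α : C →⋆ₐ[ℂ] C) (n : ℕ) (c : C) : L1 α :=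
  L1.mk α (Pi.single n c) (summable_of_ne_finset_zero (s := {n}) fun m hm => by
    rw [Pi.single_eq_of_ne (by simpa using hm), norm_zero])

@[simp] theorem L1.single_apply (n : ℕ) (c : C) (k : ℕ) :
    L1.single α n c k = (Pi.single n c : ℕ → C) k := rfl

instance : One (L1 α) := ⟨L1.single α 0 1⟩

theorem L1.one_apply (k : ℕ) : (1 : L1 α) k = if k = 0 then 1 else 0 := by
  change (Pi.single 0 1 : ℕ → C) k = _
  rw [Pi.single_apply]

theorem L1.mul_assoc (F G K : L1 α) : F * G * K = F * (G * K) := by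
  refine L1.ext fun k => ?_
  simp only [L1.mul_apply, map_sum, map_mul, Finset.sum_mul, Finset.mul_sum, Finset.sum_sigma']
  refine Finset.sum_nbij' (fun x => ⟨(x.2.1, x.2.2 + x.1.2), (x.2.2, x.1.2)⟩)
    (fun x => ⟨(x.1.1 + x.2.1, x.2.2), (x.1.1, x.2.1)⟩) ?_ ?_ ?_ ?_ ?_
  · rintro ⟨⟨a, b⟩, ⟨c, d⟩⟩ h
    simp only [Finset.mem_sigma, Finset.HasAntidiagonal.mem_antidiagonal] at h ⊢
    exact ⟨by omega, trivial⟩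
  · rintro ⟨⟨a, b⟩, ⟨c, d⟩⟩ h
    simp only [Finset.mem_sigma, Finset.HasAntidiagonal.mem_antidiagonal] at h ⊢
    exact ⟨by omega, trivial⟩
  · rintro ⟨⟨a, b⟩, ⟨c, d⟩⟩ h
    simp only [Finset.mem_sigma, Finset.HasAntidiagonal.mem_antidiagonal] at h
    obtain ⟨_, rfl⟩ := h
    rfl
  · rintro ⟨⟨a, b⟩, ⟨c, d⟩⟩ h
    simp only [Finset.mem_sigma, Finset.HasAntidiagonal.mem_antidiagonal] at h
    obtain ⟨_, rfl⟩ := h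
    rfl
  · rintro ⟨⟨a, b⟩, ⟨c, d⟩⟩ _
    simp only [_root_.mul_assoc, add_comm d b, pow_add_apply]

theorem L1.one_mul (F : L1 α) : 1 * F = F := by
  refine L1.ext fun k => ?_
  rw [L1.mul_apply, Finset.sum_eq_single (0, k)]
  · simp [L1.one_apply]
  · rintro ⟨a, b⟩ h hne
    have ha : a ≠ 0 := by
      rintro rfl
      simp only [Finset.HasAntidiagonal.mem_antidiagonal, zero_add] at h
      exact hne (by rw [h])
    simp [L1.one_apply, ha]
  · intro h
    simp at h

theorem L1.mul_one (F : L1 α) : F * 1 = F := by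
  refine L1.ext fun k => ?_
  rw [L1.mul_apply, Finset.sum_eq_single (k, 0)]
  · rw [L1.one_apply, if_pos rfl, _root_.mul_one, pow_zero_apply]
  · rintro ⟨a, b⟩ h hne
    have hb : b ≠ 0 := by
      rintro rfl
      simp only [Finset.HasAntidiagonal.mem_antidiagonal, add_zero] at h
      exact hne (by rw [h])
    simp [L1.one_apply, hb]
  · intro h
    simp at h

theorem L1.norm_mul_le (F G : L1 α) : ‖F * G‖ ≤ ‖F‖ * ‖G‖ := by
  rw [L1.norm_eq, L1.norm_eq F, L1.norm_eq G,
    F.summable_norm.tsum_mul_tsum_eq_tsum_sum_antidiagonal G.summable_norm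
      (F.summable_norm.mul_of_nonneg G.summable_norm (fun _ => norm_nonneg _)
        fun _ => norm_nonneg _)]
  exact (F * G).summable_norm.tsum_le_tsum (L1.norm_conv_le F G) (L1.summable_cauchy F G)

instance : Ring (L1 α) :=
  { (inferInstance : AddCommGroup (L1 α)), (inferInstance : Mul (L1 α)),
    (inferInstance : One (L1 α)) with
    left_distrib := fun F G K => L1.ext fun k => by
      simp [L1.mul_apply, mul_add, Finset.sum_add_distrib]
    right_distrib := fun F G K => L1.ext fun k => by
      simp [L1.mul_apply, add_mul, Finset.sum_add_distrib]
    zero_mul := fun F => L1.ext fun k => by simp [L1.mul_apply]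
    mul_zero := fun F => L1.ext fun k => by simp [L1.mul_apply]
    mul_assoc := L1.mul_assoc
    one_mul := L1.one_mul
    mul_one := L1.mul_one }

instance : NormedRing (L1 α) :=
  { (inferInstance : NormedAddCommGroup (L1 α)), (inferInstance : Ring (L1 α)) with
    norm_mul_le := L1.norm_mul_le }

instance : Algebra ℂ (L1 α) :=
  Algebra.ofModule
    (fun z F G => L1.ext fun k => by simp [L1.mul_apply, Finset.smul_sum])
    (fun z F G => L1.ext fun k => by simp [L1.mul_apply, Finset.smul_sum])

instance : NormedAlgebra ℂ (L1 α) where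
  norm_smul_le z F := _root_.norm_smul_le z F

end L1

/-! ## Matrices of operators and enveloping operator algebras -/

/-- The operator on `H^ν` (Hilbert space direct sum) given by a `ν × ν` matrix of operators
on `H`; its operator norm is the norm of `M_ν(B(H)) = B(H^ν)`. -/
def matOp {ν : ℕ} {H : Type*} [NormedAddCommGroup H] [InnerProductSpace ℂ H]
    (T : Matrix (Fin ν) (Fin ν) (H →L[ℂ] H)) :
    PiLp 2 (fun _ : Fin ν => H) →L[ℂ] PiLp 2 (fun _ : Fin ν => H) :=
  ((PiLp.continuousLinearEquiv 2 ℂ (fun _ : Fin ν => H)).symm : _ →L[ℂ] _) ∘L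
    ContinuousLinearMap.pi fun i => ∑ j, T i j ∘L PiLp.proj 2 (fun _ : Fin ν => H) j

@[simp] theorem matOp_apply {ν : ℕ} {H : Type*} [NormedAddCommGroup H] [InnerProductSpace ℂ H]
    (T : Matrix (Fin ν) (Fin ν) (H →L[ℂ] H)) (x : PiLp 2 (fun _ : Fin ν => H)) (i : Fin ν) :
    matOp T x i = ∑ j, T i j (x j) := by
  simp [matOp]

/-- A (possibly degenerate) contractive representation of a Banach algebra `B` on a Hilbert
space. -/
structure ContractiveRep (B : Type u) [NormedRing B] [NormedAlgebra ℂ B] :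
    Type (max u (w + 1)) where
  H : Type w
  [instNormed : NormedAddCommGroup H]
  [instInner : InnerProductSpace ℂ H]
  [instComplete : CompleteSpace H]
  ρ : B →ₙₐ[ℂ] (H →L[ℂ] H)
  norm_le : ∀ b, ‖ρ b‖ ≤ ‖b‖

attribute [instance] ContractiveRep.instNormed ContractiveRep.instInner ContractiveRep.instComplete

section Enveloping

variable {B : Type u} [NormedRing B] [NormedAlgebra ℂ B]

/-- `ω_ν([F_ij]) = sup {‖[ρ(F_ij)]‖ : ρ ∈ 𝓕}`. -/
def omegaMat (𝓕 : Set (ContractiveRep.{u, w} B)) {ν : ℕ} (F : Matrix (Fin ν) (Fin ν) B) : ℝ :=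
  ⨆ ρ : 𝓕, ‖matOp (F.map ρ.1.ρ)‖

/-- `ω₁(b) = sup {‖ρ(b)‖ : ρ ∈ 𝓕}`. -/
def omega (𝓕 : Set (ContractiveRep.{u, w} B)) (b : B) : ℝ := ⨆ ρ : 𝓕, ‖ρ.1.ρ b‖

variable (𝓕 : Set (ContractiveRep.{u, w} B))

theorem omega_bddAbove (b : B) : BddAbove (Set.range fun ρ : 𝓕 => ‖ρ.1.ρ b‖) :=
  ⟨‖b‖, by rintro _ ⟨ρ, rfl⟩; exact ρ.1.norm_le b⟩

theorem norm_le_omega (ρ : 𝓕) (b : B) : ‖ρ.1.ρ b‖ ≤ omega 𝓕 b :=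
  le_ciSup (omega_bddAbove 𝓕 b) ρ

theorem omega_nonneg (b : B) : 0 ≤ omega 𝓕 b :=
  Real.iSup_nonneg fun _ => norm_nonneg _

/-- A copy of `B`, equipped with the seminorm `ω₁`. -/
def PreEnveloping (_𝓕 : Set (ContractiveRep.{u, w} B)) : Type u := B

instance : Ring (PreEnveloping 𝓕) := inferInstanceAs (Ring B)
instance : Algebra ℂ (PreEnveloping 𝓕) := inferInstanceAs (Algebra ℂ B)

/-- The identity map of `B` onto its copy. -/
def PreEnveloping.of : B →ₐ[ℂ] PreEnveloping 𝓕 := AlgHom.id ℂ B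

theorem omega_add_le (a b : B) : omega 𝓕 (a + b) ≤ omega 𝓕 a + omega 𝓕 b :=
  Real.iSup_le (fun ρ => by
    rw [map_add]
    exact (norm_add_le _ _).trans (add_le_add (norm_le_omega 𝓕 ρ a) (norm_le_omega 𝓕 ρ b)))
    (add_nonneg (omega_nonneg 𝓕 a) (omega_nonneg 𝓕 b))

theorem omega_mul_le (a b : B) : omega 𝓕 (a * b) ≤ omega 𝓕 a * omega 𝓕 b :=
  Real.iSup_le (fun ρ => by
    rw [map_mul]
    exact (norm_mul_le _ _).trans (mul_le_mul (norm_le_omega 𝓕 ρ a) (norm_le_omega 𝓕 ρ b)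
      (norm_nonneg _) (omega_nonneg 𝓕 a)))
    (mul_nonneg (omega_nonneg 𝓕 a) (omega_nonneg 𝓕 b))

theorem omega_zero : omega 𝓕 0 = 0 := by simp [omega]

theorem omega_neg (a : B) : omega 𝓕 (-a) = omega 𝓕 a := by simp [omega]

/-- `ω₁` as an algebra seminorm. -/
def omegaSeminorm : RingSeminorm (PreEnveloping 𝓕) where
  toFun b := omega 𝓕 b
  map_zero' := omega_zero 𝓕
  add_le' := omega_add_le 𝓕
  neg' := omega_neg 𝓕
  mul_le' := omega_mul_le 𝓕

instance : SeminormedRing (PreEnveloping 𝓕) := (omegaSeminorm 𝓕).toSeminormedRing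

theorem PreEnveloping.norm_def (b : PreEnveloping 𝓕) : ‖b‖ = omega 𝓕 b := rfl

theorem omega_smul_le (z : ℂ) (b : B) : omega 𝓕 (z • b) ≤ ‖z‖ * omega 𝓕 b :=
  Real.iSup_le (fun ρ => by
    rw [map_smul]
    exact (norm_smul_le _ _).trans
      (mul_le_mul_of_nonneg_left (norm_le_omega 𝓕 ρ b) (norm_nonneg _)))
    (mul_nonneg (norm_nonneg _) (omega_nonneg 𝓕 b))

instance : NormedAlgebra ℂ (PreEnveloping 𝓕) :=
  { (inferInstance : Algebra ℂ (PreEnveloping 𝓕)) with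
    norm_smul_le := omega_smul_le 𝓕 }

/-- The enveloping operator algebra `𝒪(B, 𝓕)`: the Hausdorff completion of `B` for the seminorm
`ω₁`, i.e. the completion of `B / ker ω₁` for the norm induced by `ω₁`. -/
abbrev Enveloping : Type u := UniformSpace.Completion (PreEnveloping 𝓕)

/-- The canonical unital homomorphism `ι : B → 𝒪(B, 𝓕)`. -/
def Enveloping.of : B →ₐ[ℂ] Enveloping 𝓕 where
  toFun b := (PreEnveloping.of 𝓕 b : Enveloping 𝓕)
  map_one' := UniformSpace.Completion.coe_one _
  map_mul' _ _ := UniformSpace.Completion.coe_mul _ _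
  map_zero' := UniformSpace.Completion.coe_zero
  map_add' _ _ := UniformSpace.Completion.coe_add _ _
  commutes' _ := rfl

/-- The extension `ρ~` to `𝒪(B, 𝓕)` of a representation `ρ ∈ 𝓕`, with `ρ~ ∘ ι = ρ`. -/
def Enveloping.extend (ρ : 𝓕) : Enveloping 𝓕 → (ρ.1.H →L[ℂ] ρ.1.H) :=
  UniformSpace.Completion.extension fun b : PreEnveloping 𝓕 => ρ.1.ρ b

theorem Enveloping.uniformContinuous_rep (ρ : 𝓕) :
    UniformContinuous fun b : PreEnveloping 𝓕 => ρ.1.ρ b := by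
  refine LipschitzWith.uniformContinuous (K := 1) (LipschitzWith.of_dist_le_mul fun a b => ?_)
  rw [dist_eq_norm, dist_eq_norm, PreEnveloping.norm_def, NNReal.coe_one, _root_.one_mul]
  exact (congrArg norm (map_sub ρ.1.ρ (a : B) (b : B)).symm).trans_le (norm_le_omega 𝓕 ρ _)

theorem Enveloping.extend_of (ρ : 𝓕) (b : B) :
    Enveloping.extend 𝓕 ρ (Enveloping.of 𝓕 b) = ρ.1.ρ b :=
  UniformSpace.Completion.extension_coe (Enveloping.uniformContinuous_rep 𝓕 ρ) _

/-- The norm of `M_ν(𝒪(B, 𝓕))`, the continuous extension of `ω_ν`: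
`‖[a_ij]‖_ν = sup {‖[ρ~(a_ij)]‖ : ρ ∈ 𝓕}`. -/
def Enveloping.matrixNorm {ν : ℕ} (a : Matrix (Fin ν) (Fin ν) (Enveloping 𝓕)) : ℝ :=
  ⨆ ρ : 𝓕, ‖matOp (a.map (Enveloping.extend 𝓕 ρ))‖

theorem Enveloping.matrixNorm_of {ν : ℕ} (F : Matrix (Fin ν) (Fin ν) B) :
    Enveloping.matrixNorm 𝓕 (F.map (Enveloping.of 𝓕)) = omegaMat 𝓕 F := by
  unfold Enveloping.matrixNorm omegaMat
  refine iSup_congr fun ρ => ?_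
  congr 2
  funext i j
  exact Enveloping.extend_of 𝓕 ρ (F i j)

end Enveloping

/-! ## Left covariant pairs -/

/-- A left covariant contractive pair `(π, V)` for `(C, α)` on a Hilbert space `H`: a (possibly
degenerate) *-representation `π` of `C` and a contraction `V` with `π(c) V = V π(α(c))`. -/
structure LeftCovariantPair {C : Type u} [CStarAlgebra C] (α : C →⋆ₐ[ℂ] C) :
    Type (max u (w + 1)) where
  H : Type w
  [instNormed : NormedAddCommGroup H]
  [instInner : InnerProductSpace ℂ H]
  [instComplete : CompleteSpace H]
  π : C →⋆ₙₐ[ℂ] (H →L[ℂ] H)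
  V : H →L[ℂ] H
  norm_V_le : ‖V‖ ≤ 1
  covariant : ∀ c, π c * V = V * π (α c)

attribute [instance] LeftCovariantPair.instNormed LeftCovariantPair.instInner
  LeftCovariantPair.instComplete

namespace LeftCovariantPair

variable {C : Type u} [CStarAlgebra C] {α : C →⋆ₐ[ℂ] C}

/-- The pair is isometric: `V` is an isometry. -/
def IsIsometric (P : LeftCovariantPair.{u, w} α) : Prop := Isometry P.V

variable (P : LeftCovariantPair.{u, w} α)

theorem norm_V_pow_le (n : ℕ) : ‖P.V ^ n‖ ≤ 1 := by
  induction n with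
  | zero =>
    rw [pow_zero]
    exact ContinuousLinearMap.norm_id_le
  | succ n ih =>
    rw [pow_succ]
    exact (norm_mul_le _ _).trans (mul_le_one₀ ih (norm_nonneg _) P.norm_V_le)

theorem norm_term_le (n : ℕ) (c : C) : ‖P.V ^ n * P.π c‖ ≤ ‖c‖ :=
  (norm_mul_le _ _).trans <| (mul_le_mul (P.norm_V_pow_le n)
    (NonUnitalStarAlgHom.norm_apply_le P.π c) (norm_nonneg _) zero_le_one).trans_eq
    (_root_.one_mul _)

theorem summable_norm_term (F : L1 α) : Summable fun n => ‖P.V ^ n * P.π (F n)‖ :=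
  F.summable_norm.of_nonneg_of_le (fun _ => norm_nonneg _) fun n => P.norm_term_le n (F n)

theorem covariant_pow (n : ℕ) (c : C) : P.π c * P.V ^ n = P.V ^ n * P.π ((α ^ n) c) := by
  induction n generalizing c with
  | zero => rw [pow_zero, pow_zero, _root_.mul_one, _root_.one_mul]; rfl
  | succ n ih =>
    rw [pow_succ' P.V, ← _root_.mul_assoc, P.covariant, _root_.mul_assoc, ih, ← _root_.mul_assoc,
      pow_succ α]
    rfl

/-- The integrated form `V × π` of a left covariant pair: `(V × π)(∑ δₙ ⊗ cₙ) = ∑ Vⁿ π(cₙ)`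
(the series converges absolutely in operator norm). -/
def integrated : L1 α →ₙₐ[ℂ] (P.H →L[ℂ] P.H) where
  toFun F := ∑' n, P.V ^ n * P.π (F n)
  map_smul' z F := by
    rw [MonoidHom.id_apply, ← (P.summable_norm_term F).of_norm.tsum_const_smul]
    refine tsum_congr fun n => ?_
    rw [L1.smul_apply, map_smul, mul_smul_comm]
  map_zero' := by simp
  map_add' F G := by
    rw [← (P.summable_norm_term F).of_norm.tsum_add (P.summable_norm_term G).of_norm]
    refine tsum_congr fun n => ?_
    rw [L1.add_apply, map_add, mul_add]
  map_mul' F G := by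
    rw [tsum_mul_tsum_eq_tsum_sum_antidiagonal_of_summable_norm (P.summable_norm_term F)
      (P.summable_norm_term G)]
    refine tsum_congr fun k => ?_
    rw [L1.mul_apply, map_sum, Finset.mul_sum]
    refine Finset.sum_congr rfl fun p hp => ?_
    rw [← Finset.HasAntidiagonal.mem_antidiagonal.1 hp, map_mul, pow_add, _root_.mul_assoc (P.V ^ p.1),
      _root_.mul_assoc (P.V ^ p.1), ← _root_.mul_assoc (P.V ^ p.2), ← P.covariant_pow,
      _root_.mul_assoc (P.π _)]

theorem integrated_apply (F : L1 α) : P.integrated F = ∑' n, P.V ^ n * P.π (F n) := rfl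

theorem norm_integrated_le (F : L1 α) : ‖P.integrated F‖ ≤ ‖F‖ := by
  rw [L1.norm_eq, integrated_apply]
  exact (norm_tsum_le_tsum_norm (P.summable_norm_term F)).trans
    ((P.summable_norm_term F).tsum_le_tsum (fun n => P.norm_term_le n (F n)) F.summable_norm)

/-- `V × π` as a contractive representation of `ℓ¹(ℤ₊, C, α)_l`. -/
def toRep : ContractiveRep.{u, w} (L1 α) where
  H := P.H
  ρ := P.integrated
  norm_le := P.norm_integrated_le

/-- The C*-algebra `C*(π, V)` generated by the range of `V × π`. -/
def cstar : NonUnitalStarSubalgebra ℂ (P.H →L[ℂ] P.H) :=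
  (NonUnitalStarAlgebra.adjoin ℂ (Set.range P.integrated)).topologicalClosure

/-- `(V × π)(F)` as an element of `C*(π, V)`. -/
def gen (F : L1 α) : P.cstar :=
  ⟨P.integrated F, NonUnitalStarSubalgebra.le_topologicalClosure _
    (NonUnitalStarAlgebra.subset_adjoin ℂ _ ⟨F, rfl⟩)⟩

/-- The set of polynomials `∑_{n=0}^k Vⁿ π(cₙ)` in `C*(π, V)`. -/
def polynomials : Set P.cstar :=
  {x | ∃ (k : ℕ) (c : ℕ → C),
    (x : P.H →L[ℂ] P.H) = ∑ n ∈ Finset.range (k + 1), P.V ^ n * P.π (c n)}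

end LeftCovariantPair

/-! ## The semicrossed products -/

section Algebras

variable {C : Type u} [CStarAlgebra C] (α : C →⋆ₐ[ℂ] C)

/-- The representations `V × π`, for `(π, V)` a left covariant contractive pair. -/
def contrReps : Set (ContractiveRep.{u, w} (L1 α)) :=
  {ρ | ∃ P : LeftCovariantPair.{u, w} α, P.toRep = ρ}

/-- The representations `V × π`, for `(π, V)` a left covariant isometric pair. -/
def isomReps : Set (ContractiveRep.{u, w} (L1 α)) :=
  {ρ | ∃ P : LeftCovariantPair.{u, w} α, P.IsIsometric ∧ P.toRep = ρ}

/-- The semicrossed product `𝔄(C, α, contr)_l`. -/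
abbrev SemicrossedContr : Type u := Enveloping (contrReps.{u, w} α)

/-- The semicrossed product `𝔄(C, α, is)_l`. -/
abbrev SemicrossedIsom : Type u := Enveloping (isomReps.{u, w} α)

end Algebras

/-! ## The universal isometric pair and the pair `(π~, S)` -/

/-- The diagonal operator `diag(Tᵢ)` on the Hilbert space direct sum, for a bounded family. -/
abbrev diagOp {ι : Type*} {E : ι → Type*} [∀ i, NormedAddCommGroup (E i)]
    [∀ i, InnerProductSpace ℂ (E i)] (T : ∀ i, E i →L[ℂ] E i) {K : ℝ} (hK : 0 ≤ K)
    (hT : ∀ i, ‖T i‖ ≤ K) : lp E 2 →L[ℂ] lp E 2 :=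
  lp.mapCLM 2 T hK hT

/-- The direct sum `c ↦ diag(πᵢ(c))` of a family of representations. -/
def diagRep {C : Type u} [CStarAlgebra C] {ι : Type*} {E : ι → Type*}
    [∀ i, NormedAddCommGroup (E i)] [∀ i, InnerProductSpace ℂ (E i)] [∀ i, CompleteSpace (E i)]
    (π : ∀ i, C →⋆ₙₐ[ℂ] (E i →L[ℂ] E i)) : C →⋆ₙₐ[ℂ] (lp E 2 →L[ℂ] lp E 2) where
  toFun c := diagOp (fun i => π i c) (norm_nonneg c)
    fun i => NonUnitalStarAlgHom.norm_apply_le (π i) c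
  map_smul' z c := by ext x i; simp
  map_zero' := by ext x i; simp
  map_add' c d := by ext x i; simp
  map_mul' c d := by ext x i; simp
  map_star' c := by
    refine (ContinuousLinearMap.eq_adjoint_iff _ _).2 fun x y => ?_
    rw [lp.inner_eq_tsum, lp.inner_eq_tsum]
    refine tsum_congr fun i => ?_
    simp [map_star, ContinuousLinearMap.star_eq_adjoint, ContinuousLinearMap.adjoint_inner_left]

section Shift

variable (H₀ : Type w) [NormedAddCommGroup H₀]

/-- `(x₀, x₁, …) ↦ (0, x₀, x₁, …)`. -/
def shiftFun {H₀ : Type w} [Zero H₀] (x : ℕ → H₀) : ℕ → H₀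
  | 0 => 0
  | n + 1 => x n

theorem shift_hasSum (x : lp (fun _ : ℕ => H₀) 2) :
    HasSum (fun n => ‖shiftFun (fun k => x k) n‖ ^ (2 : ℝ)) (‖x‖ ^ (2 : ℝ)) := by
  have h := lp.hasSum_norm (p := 2) (by simp) x
  simp only [ENNReal.toReal_ofNat] at h
  rw [← hasSum_nat_add_iff' 1]
  simpa [shiftFun] using h

variable [InnerProductSpace ℂ H₀]

/-- `S = I ⊗ s` on `H₀ ⊗ ℓ²(ℤ₊) = ℓ²(ℤ₊, H₀)`, where `s` is the unilateral shift. -/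
def shift : lp (fun _ : ℕ => H₀) 2 →ₗᵢ[ℂ] lp (fun _ : ℕ => H₀) 2 where
  toFun x := ⟨shiftFun fun k => x k,
    memℓp_gen (by simpa using (shift_hasSum H₀ x).summable)⟩
  map_add' x y := by
    refine lp.ext (funext fun n => ?_)
    cases n with
    | zero => exact (add_zero (0 : H₀)).symm
    | succ n => rfl
  map_smul' z x := by
    refine lp.ext (funext fun n => ?_)
    cases n with
    | zero => exact (smul_zero z).symm
    | succ n => rfl
  norm_map' x := by
    have h := lp.hasSum_norm (p := 2) (by simp)
      (⟨shiftFun fun k => x k, memℓp_gen (by simpa using (shift_hasSum H₀ x).summable)⟩ :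
        lp (fun _ : ℕ => H₀) 2)
    simp only [ENNReal.toReal_ofNat] at h
    exact (Real.rpow_left_inj (norm_nonneg _) (norm_nonneg _) two_ne_zero).1
      (h.unique (shift_hasSum H₀ x))

@[simp] theorem shift_zero (x : lp (fun _ : ℕ => H₀) 2) : shift H₀ x 0 = 0 := rfl
@[simp] theorem shift_succ (x : lp (fun _ : ℕ => H₀) 2) (n : ℕ) : shift H₀ x (n + 1) = x n := rfl

end Shift

section Pairs

variable {C : Type u} [CStarAlgebra C] (α : C →⋆ₐ[ℂ] C)

/-- The pair `(π~, S)` on `H₀ ⊗ ℓ²(ℤ₊)`, with `π~(c) = diag(π(αⁿ(c)) : n ∈ ℤ₊)`. -/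
def shiftPair {H₀ : Type w} [NormedAddCommGroup H₀] [InnerProductSpace ℂ H₀] [CompleteSpace H₀]
    (π : C →⋆ₙₐ[ℂ] (H₀ →L[ℂ] H₀)) : LeftCovariantPair.{u, w} α where
  H := lp (fun _ : ℕ => H₀) 2
  π := diagRep fun n : ℕ => π.comp ((α ^ n : C →⋆ₐ[ℂ] C) : C →⋆ₙₐ[ℂ] C)
  V := (shift H₀).toContinuousLinearMap
  norm_V_le := (shift H₀).norm_toContinuousLinearMap_le
  covariant c := by
    ext x n
    cases n with
    | zero => simp [diagRep]
    | succ n =>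
      have h : (α ^ (n + 1)) c = (α ^ n) (α c) := by rw [pow_succ]; rfl
      simp [diagRep, h]

theorem shiftPair_isIsometric {H₀ : Type w} [NormedAddCommGroup H₀] [InnerProductSpace ℂ H₀]
    [CompleteSpace H₀] (π : C →⋆ₙₐ[ℂ] (H₀ →L[ℂ] H₀)) : (shiftPair α π).IsIsometric :=
  (shift H₀).isometry

/-- The universal pair `(π_u, V_u)`: the direct sum of all left covariant isometric pairs. -/
def universalPair : LeftCovariantPair.{u, max u (w + 1)} α where
  H := lp (fun P : {P : LeftCovariantPair.{u, w} α // P.IsIsometric} => P.1.H) 2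
  π := diagRep fun P : {P : LeftCovariantPair.{u, w} α // P.IsIsometric} => P.1.π
  V := diagOp (fun P : {P : LeftCovariantPair.{u, w} α // P.IsIsometric} => P.1.V) zero_le_one
    fun P => P.1.norm_V_le
  norm_V_le := lp.norm_mapCLM_le _ _ _ _
  covariant c := by
    ext x P
    have h := DFunLike.congr_fun (P.1.covariant c) (x P)
    simpa [diagRep] using h

end Pairs

end Semicrossed

end

noncomputable section

namespace Semicrossed

open Filter Topology ContinuousLinearMap

/-! ## Matrices of operators -/

section MatOp

variable {ν : ℕ} {H K : Type*} [NormedAddCommGroup H] [InnerProductSpace ℂ H]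
  [NormedAddCommGroup K] [InnerProductSpace ℂ K]

/-! Everything rests on one estimate. For a left covariant contractive pair (π, V) and a faithful
π₀, the norm of any matrix of finite sums ∑ V^m π(c) V*^n is at most that of the corresponding
matrix for (π₀~, S) (`norm_matOp_symEval_le`). Its proof has three ingredients.

Dilation. If ‖V‖ < 1, the Poisson kernel K x = ((1 - VV*)^{1/2} V*^n x)ₙ is an isometry with S*K =
KV* and π~(c)K = Kπ(c). Hence K* S^m π~(c) S*^n K = V^m π(c) V*^n, and compression by K does not
increase norms (`poissonOp_compress_symEval`).

Change of representation. Cut down to the first N coordinates, ∑ S^m π~(c) S*^n is the image under π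
of an N × N matrix over C whose entries do not depend on π. A faithful representation is isometric
on matrices over C and every representation is contractive, so π may be replaced by π₀
(`norm_matOp_symEval_shiftOp_le`).

Scaling. A general contraction V is the norm limit of rV as r increases to 1, and rV is still
covariant.

For (2), the sums with n = 0 approximate the integrated forms. The pair (π₀~, S) is itself
isometric, so it attains the suprema that define both semicrossed products, and both embed
completely isometrically with the same range (`exists_realization`).

For (1), V*V = 1 makes the sums ∑ V^m π(c) V*^n a dense *-subalgebra of the generated C*-algebra.
The pair (π₀~, S) is a direct summand of the universal one, so compression to it is a
*-homomorphism, and by the estimate it is isometric (`IsSummand.exists_starAlgHom`). -/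

theorem matOp_sub (S T : Matrix (Fin ν) (Fin ν) (H →L[ℂ] H)) :
    matOp (S - T) = matOp S - matOp T := by
  ext x i
  simp

/-- The ℓ² norm is at most the ℓ¹ norm. The crude bound serves only to turn entrywise convergence
into norm convergence. -/
theorem norm_matOp_le_sum (T : Matrix (Fin ν) (Fin ν) (H →L[ℂ] H)) :
    ‖matOp T‖ ≤ ∑ i, ∑ j, ‖T i j‖ := by
  refine ContinuousLinearMap.opNorm_le_bound (matOp T)
    (Finset.sum_nonneg fun i _ => Finset.sum_nonneg fun j _ => norm_nonneg (T i j)) fun x => ?_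
  calc ‖matOp T x‖ ≤ ∑ i, ‖matOp T x i‖ := by
        rw [PiLp.norm_eq_of_L2]
        refine Real.sqrt_le_iff.2 ⟨Finset.sum_nonneg fun i _ => norm_nonneg _, ?_⟩
        exact Finset.sum_sq_le_sq_sum_of_nonneg fun i _ => norm_nonneg _
    _ ≤ ∑ i, ∑ j, ‖T i j‖ * ‖x‖ := by
        refine Finset.sum_le_sum fun i _ => ?_
        rw [matOp_apply]
        exact norm_sum_le_of_le _ fun j _ => (T i j).le_opNorm_of_le (PiLp.norm_apply_le x j)
    _ = (∑ i, ∑ j, ‖T i j‖) * ‖x‖ := by simp_rw [Finset.sum_mul]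

theorem tendsto_norm_matOp {ι : Type*} {l : Filter ι}
    {T : ι → Matrix (Fin ν) (Fin ν) (H →L[ℂ] H)} {T₀ : Matrix (Fin ν) (Fin ν) (H →L[ℂ] H)}
    (h : ∀ i j, Tendsto (fun k => T k i j) l (𝓝 (T₀ i j))) :
    Tendsto (fun k => ‖matOp (T k)‖) l (𝓝 ‖matOp T₀‖) := by
  rw [tendsto_iff_norm_sub_tendsto_zero]
  have h₀ : Tendsto (fun k => ∑ i, ∑ j, ‖T k i j - T₀ i j‖) l (𝓝 0) := by
    have := tendsto_finsetSum (Finset.univ : Finset (Fin ν)) fun i _ =>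
      tendsto_finsetSum (Finset.univ : Finset (Fin ν)) fun j _ =>
        tendsto_iff_norm_sub_tendsto_zero.1 (h i j)
    simpa using this
  refine squeeze_zero (fun k => norm_nonneg _) (fun k => ?_) h₀
  rw [Real.norm_eq_abs]
  exact (abs_norm_sub_norm_le (matOp (T k)) (matOp T₀)).trans
    (by rw [← matOp_sub]; exact norm_matOp_le_sum (T k - T₀))

theorem norm_piLp_map_le (A : H →L[ℂ] K) (hA : ‖A‖ ≤ 1) (x : PiLp 2 (fun _ : Fin ν => H)) :
    ‖(WithLp.toLp 2 fun i => A (x i) : PiLp 2 (fun _ : Fin ν => K))‖ ≤ ‖x‖ := by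
  rw [PiLp.norm_eq_of_L2, PiLp.norm_eq_of_L2]
  refine Real.sqrt_le_sqrt (Finset.sum_le_sum fun i _ => ?_)
  exact pow_le_pow_left₀ (norm_nonneg _) ((A.le_of_opNorm_le hA _).trans_eq (one_mul _)) 2

/-- Compressing all entries of an operator matrix by contractions does not increase its norm. -/
theorem norm_matOp_compress_le (A : K →L[ℂ] H) (B : H →L[ℂ] K) (hA : ‖A‖ ≤ 1) (hB : ‖B‖ ≤ 1)
    (T : Matrix (Fin ν) (Fin ν) (K →L[ℂ] K)) :
    ‖matOp (T.map fun Y => A ∘L Y ∘L B)‖ ≤ ‖matOp T‖ := by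
  refine ContinuousLinearMap.opNorm_le_bound _ (norm_nonneg (matOp T)) fun x => ?_
  have h : matOp (T.map fun Y => A ∘L Y ∘L B) x =
      WithLp.toLp 2 fun i => A (matOp T (WithLp.toLp 2 fun j => B (x j)) i) := by
    ext i
    simp
  rw [h]
  exact (norm_piLp_map_le A hA _).trans (((matOp T).le_opNorm _).trans
    (mul_le_mul_of_nonneg_left (norm_piLp_map_le B hB x) (norm_nonneg (matOp T))))

theorem norm_matOp_one (T : Matrix (Fin 1) (Fin 1) (H →L[ℂ] H)) : ‖matOp T‖ = ‖T 0 0‖ := by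
  refine le_antisymm ((norm_matOp_le_sum T).trans_eq (by simp)) ?_
  refine ContinuousLinearMap.opNorm_le_bound _ (norm_nonneg (matOp T)) fun x => ?_
  have h := (matOp T).le_opNorm (WithLp.toLp 2 fun _ => x)
  rw [PiLp.norm_eq_of_L2, PiLp.norm_eq_of_L2] at h
  simpa using h

end MatOp

/-! ## Representations of matrix algebras -/

section MatRep

variable {A : Type*} [NonUnitalCStarAlgebra A] {H : Type*} [NormedAddCommGroup H]
  [InnerProductSpace ℂ H] [CompleteSpace H] (ν : ℕ)

/-- The amplification of a representation of `A` on `H` to a representation of `M_ν(A)` on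
`H^ν`. -/
def matRep (ρ : A →⋆ₙₐ[ℂ] (H →L[ℂ] H)) :
    CStarMatrix (Fin ν) (Fin ν) A →⋆ₙₐ[ℂ]
      (PiLp 2 (fun _ : Fin ν => H) →L[ℂ] PiLp 2 (fun _ : Fin ν => H)) where
  toFun x := matOp (Matrix.of fun i j => ρ (x i j))
  map_smul' z x := by ext v i; simp [Finset.smul_sum]
  map_zero' := by ext v i; simp
  map_add' x y := by ext v i; simp [Finset.sum_add_distrib]
  map_mul' x y := by
    ext v i
    simp only [CStarMatrix.mul_apply, map_sum, map_mul, matOp_apply, Matrix.of_apply, sum_apply,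
      mul_apply_eq_comp]
    exact Finset.sum_comm
  map_star' x := by
    rw [ContinuousLinearMap.star_eq_adjoint]
    refine (ContinuousLinearMap.eq_adjoint_iff _ _).2 fun v y => ?_
    simp only [PiLp.inner_apply, matOp_apply, Matrix.of_apply, CStarMatrix.star_apply, map_star,
      sum_inner, inner_sum, ContinuousLinearMap.star_eq_adjoint, ContinuousLinearMap.adjoint_inner_left]
    exact Finset.sum_comm

theorem matRep_apply (ρ : A →⋆ₙₐ[ℂ] (H →L[ℂ] H)) (x : CStarMatrix (Fin ν) (Fin ν) A) :
    matRep ν ρ x = matOp (Matrix.of fun i j => ρ (x i j)) := rfl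

theorem matRep_injective {ρ : A →⋆ₙₐ[ℂ] (H →L[ℂ] H)} (hρ : Function.Injective ρ) :
    Function.Injective (matRep ν ρ) := by
  intro x y h
  refine CStarMatrix.ext fun i j => hρ (ContinuousLinearMap.ext fun v => ?_)
  -- A vector supported in the j-th summand reads off the j-th column.
  have h' := congrArg (fun z => z i) (DFunLike.congr_fun h (PiLp.single 2 j v))
  simp only [matRep_apply, matOp_apply, Matrix.of_apply] at h'
  rw [Finset.sum_eq_single j, Finset.sum_eq_single j] at h'
  · simpa using h'
  · intro b _ hb; simp [hb]
  · simp
  · intro b _ hb; simp [hb]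
  · simp

/-- A faithful representation dominates every representation on doubly indexed matrices. -/
theorem norm_matOp_matOp_le {C : Type*} [CStarAlgebra C] {K : Type*} [NormedAddCommGroup K]
    [InnerProductSpace ℂ K] [CompleteSpace K] (σ : C →⋆ₙₐ[ℂ] (K →L[ℂ] K))
    {ρ : C →⋆ₙₐ[ℂ] (H →L[ℂ] H)} (hρ : Function.Injective ρ) (N : ℕ)
    (x : Fin ν → Fin ν → Fin N → Fin N → C) :
    ‖matOp (Matrix.of fun i j => matOp (Matrix.of fun a b => σ (x i j a b)))‖ ≤
      ‖matOp (Matrix.of fun i j => matOp (Matrix.of fun a b => ρ (x i j a b)))‖ := by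
  -- The C*-structure on matrices over `C` refers to an order on `C`; the spectral order serves.
  let _ : PartialOrder C := CStarAlgebra.spectralOrder C
  let _ : StarOrderedRing C := CStarAlgebra.spectralOrderedRing C
  let X : CStarMatrix (Fin ν) (Fin ν) (CStarMatrix (Fin N) (Fin N) C) :=
    CStarMatrix.ofMatrix fun i j => CStarMatrix.ofMatrix (x i j)
  -- A *-homomorphism of C*-algebras is contractive, and an injective one is isometric; both facts
  -- are applied to the same matrix `X`.
  have h₁ := NonUnitalStarAlgHom.norm_apply_le (matRep ν (matRep N σ)) X
  have h₂ := NonUnitalStarAlgHom.norm_map (matRep ν (matRep N ρ))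
    (matRep_injective ν (matRep_injective N hρ)) X
  exact h₁.trans_eq h₂.symm

end MatRep

/-! ## The shift and its truncations -/

section Shift

variable (K : Type*) [NormedAddCommGroup K] [InnerProductSpace ℂ K]

/-- The unilateral shift `S` on `ℓ²(ℤ₊, K)` as a bounded operator. -/
def shiftOp : lp (fun _ : ℕ => K) 2 →L[ℂ] lp (fun _ : ℕ => K) 2 :=
  (shift K).toContinuousLinearMap

variable {K}

theorem shiftOp_pow_apply (m : ℕ) (x : lp (fun _ : ℕ => K) 2) (a : ℕ) :
    (shiftOp K ^ m) x a = if m ≤ a then x (a - m) else 0 := by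
  induction m generalizing a with
  | zero => simp
  | succ m ih =>
    rw [pow_succ']
    cases a with
    | zero => exact shift_zero K _
    | succ a =>
      refine (shift_succ K _ a).trans ((ih a).trans ?_)
      simp

section Complete

variable [CompleteSpace K]

theorem star_shiftOp_apply (x : lp (fun _ : ℕ => K) 2) (a : ℕ) :
    star (shiftOp K) x a = x (a + 1) := by
  -- Pairing with h placed at coordinate a reduces the claim to the fact that S moves this vector to
  -- coordinate a + 1.
  refine ext_inner_left ℂ fun h => ?_
  refine (lp.inner_single_left (G := fun _ : ℕ => K) a h _).symm.trans
    (Eq.trans ?_ (lp.inner_single_left (a + 1) h x))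
  rw [ContinuousLinearMap.star_eq_adjoint, ContinuousLinearMap.adjoint_inner_right]
  congr 1
  refine lp.ext (funext fun b => ?_)
  cases b with
  | zero =>
    rw [lp.single_apply_ne _ _ _ (by omega)]
    exact shift_zero K _
  | succ b =>
    refine (shift_succ K _ b).trans ?_
    simp [lp.single_apply, Pi.single_apply]

theorem star_shiftOp_pow_apply (n : ℕ) (x : lp (fun _ : ℕ => K) 2) (a : ℕ) :
    (star (shiftOp K) ^ n) x a = x (a + n) := by
  induction n generalizing a with
  | zero => simp
  | succ n ih =>
    rw [pow_succ', mul_apply_eq_comp, star_shiftOp_apply, ih]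
    exact congrArg (fun k => x k) (by omega)

end Complete

variable (K) in
/-- The first `N` coordinates of a vector in `ℓ²(ℤ₊, K)`. -/
def trunc (N : ℕ) : lp (fun _ : ℕ => K) 2 →L[ℂ] PiLp 2 (fun _ : Fin N => K) :=
  LinearMap.mkContinuous
    { toFun := fun x => WithLp.toLp 2 fun a => x a
      map_add' := fun x y => by ext a; simp
      map_smul' := fun z x => by ext a; simp } 1 fun x => by
    rw [_root_.one_mul, PiLp.norm_eq_of_L2]
    refine Real.sqrt_le_iff.2 ⟨norm_nonneg x, ?_⟩
    have h := lp.sum_rpow_le_norm_rpow (p := 2) (by simp) x (Finset.range N)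
    simp only [ENNReal.toReal_ofNat, Real.rpow_two] at h
    rwa [← Fin.sum_univ_eq_sum_range fun a => ‖x a‖ ^ 2] at h

theorem norm_trunc_le (N : ℕ) : ‖trunc K N‖ ≤ 1 := LinearMap.mkContinuous_norm_le _ zero_le_one _

variable [CompleteSpace K]

theorem adjoint_trunc_apply (N : ℕ) (y : PiLp 2 (fun _ : Fin N => K)) :
    adjoint (trunc K N) y = ∑ a : Fin N, lp.single 2 (a : ℕ) (y a) := by
  refine ext_inner_right ℂ fun x => ?_
  rw [ContinuousLinearMap.adjoint_inner_left, sum_inner, PiLp.inner_apply]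
  exact Finset.sum_congr rfl fun a _ => (lp.inner_single_left (a : ℕ) (y a) x).symm

theorem norm_adjoint_trunc_le (N : ℕ) : ‖adjoint (trunc K N)‖ ≤ 1 :=
  (LinearIsometryEquiv.norm_map _ _).trans_le (norm_trunc_le N)

theorem tendsto_adjoint_trunc_trunc (x : lp (fun _ : ℕ => K) 2) :
    Tendsto (fun N => adjoint (trunc K N) (trunc K N x)) atTop (𝓝 x) := by
  refine (lp.hasSum_single (by simp) x).tendsto_sum_nat.congr fun N => ?_
  rw [adjoint_trunc_apply, ← Fin.sum_univ_eq_sum_range fun a => lp.single 2 a (x a)]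
  rfl

theorem norm_adjoint_trunc_trunc_le (N : ℕ) :
    ‖adjoint (trunc K N) ∘L trunc K N‖ ≤ 1 :=
  (opNorm_comp_le _ _).trans (mul_le_one₀ (norm_adjoint_trunc_le N) (norm_nonneg _)
    (norm_trunc_le N))

/-- An operator matrix on `ℓ²(ℤ₊, K)` is bounded by its truncations. -/
theorem norm_matOp_le_of_trunc {ν : ℕ}
    (T : Matrix (Fin ν) (Fin ν) (lp (fun _ : ℕ => K) 2 →L[ℂ] lp (fun _ : ℕ => K) 2)) {M : ℝ}
    (hM : ∀ N, ‖matOp (T.map fun Y => trunc K N ∘L Y ∘L adjoint (trunc K N))‖ ≤ M) :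
    ‖matOp T‖ ≤ M := by
  have hM₀ : 0 ≤ M :=
    (norm_nonneg (matOp (T.map fun Y => trunc K 0 ∘L Y ∘L adjoint (trunc K 0)))).trans (hM 0)
  refine opNorm_le_bound _ hM₀ fun x => ?_
  -- The projections onto the first N coordinates tend to 1 strongly, not in norm, so the bound is
  -- passed to the limit vector by vector.
  let Q : ℕ → lp (fun _ : ℕ => K) 2 →L[ℂ] lp (fun _ : ℕ => K) 2 :=
    fun N => adjoint (trunc K N) ∘L trunc K N
  have hQ (N : ℕ) : ‖matOp (T.map fun Y => Q N ∘L Y ∘L Q N)‖ ≤ M :=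
    (norm_matOp_compress_le (adjoint (trunc K N)) (trunc K N) (norm_adjoint_trunc_le N)
      (norm_trunc_le N) (T.map fun Y => trunc K N ∘L Y ∘L adjoint (trunc K N))).trans (hM N)
  -- The vector under the outer projection also varies with N, which is harmless because the
  -- projections are uniformly bounded.
  have hlim (z : ℕ → lp (fun _ : ℕ => K) 2) (z₀) (hz : Tendsto z atTop (𝓝 z₀)) :
      Tendsto (fun N => Q N (z N)) atTop (𝓝 z₀) := by
    have h₁ : Tendsto (fun N => Q N (z N - z₀)) atTop (𝓝 0) := by
      refine squeeze_zero_norm (fun N => ?_) (tendsto_iff_norm_sub_tendsto_zero.1 hz)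
      exact ((Q N).le_of_opNorm_le (norm_adjoint_trunc_trunc_le N) _).trans_eq
        (_root_.one_mul _)
    refine (zero_add z₀ ▸ h₁.add (tendsto_adjoint_trunc_trunc z₀)).congr fun N => ?_
    rw [map_sub]
    exact sub_add_cancel _ _
  have hx : Tendsto (fun N => matOp (T.map fun Y => Q N ∘L Y ∘L Q N) x) atTop
      (𝓝 (matOp T x)) := by
    refine ((PiLp.continuous_toLp 2 _).tendsto (fun i => matOp T x i)).comp
      (f := fun N i => matOp (T.map fun Y => Q N ∘L Y ∘L Q N) x i) ?_
    refine tendsto_pi_nhds.2 fun i => ?_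
    simp only [matOp_apply, Matrix.map_apply, comp_apply]
    refine tendsto_finsetSum _ fun j _ => hlim _ _ ?_
    exact ((T i j).continuous.tendsto _).comp (tendsto_adjoint_trunc_trunc _)
  exact le_of_tendsto hx.norm (Eventually.of_forall fun N =>
    (matOp (T.map fun Y => Q N ∘L Y ∘L Q N)).le_of_opNorm_le (hQ N) x)

end Shift

/-! ## Noncommutative polynomials `∑ V^m π(c) V*^n` -/

section Symbol

variable {C : Type u} [CStarAlgebra C] {H : Type*} [NormedAddCommGroup H] [InnerProductSpace ℂ H]
  [CompleteSpace H]

/-- The operator `∑ V^m π(p(m, n)) V*^n`. -/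
def symEval (π : C →⋆ₙₐ[ℂ] (H →L[ℂ] H)) (V : H →L[ℂ] H) (p : ℕ × ℕ →₀ C) : H →L[ℂ] H :=
  p.sum fun k c => V ^ k.1 * π c * star V ^ k.2

/-- The representation `π~(c) = diag(π(αⁿ(c)))` on `ℓ²(ℤ₊, H)`. -/
def orbitRep (α : C →⋆ₐ[ℂ] C) (π : C →⋆ₙₐ[ℂ] (H →L[ℂ] H)) :
    C →⋆ₙₐ[ℂ] (lp (fun _ : ℕ => H) 2 →L[ℂ] lp (fun _ : ℕ => H) 2) :=
  diagRep fun n : ℕ => π.comp ((α ^ n : C →⋆ₐ[ℂ] C) : C →⋆ₙₐ[ℂ] C)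

theorem orbitRep_apply (α : C →⋆ₐ[ℂ] C) (π : C →⋆ₙₐ[ℂ] (H →L[ℂ] H)) (c : C)
    (x : lp (fun _ : ℕ => H) 2) (n : ℕ) : orbitRep α π c x n = π ((α ^ n) c) (x n) := rfl

/-- The matrix entries of `∑ S^m π~(p(m, n)) S*^n`, as elements of `C`. -/
def symEntry (α : C →⋆ₐ[ℂ] C) (p : ℕ × ℕ →₀ C) (a b : ℕ) : C :=
  p.sum fun k c => if k.1 ≤ a ∧ a - k.1 + k.2 = b then (α ^ (a - k.1)) c else 0

/-- S*^n moves coordinate b to b - n, where π~(c) acts as π(α^{b-n}(c)), and S^m moves the result to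
b - n + m. So only terms with a - m = b - n ≥ 0 contribute; the guard `k.1 ≤ a` excludes truncated
subtraction. -/
theorem symEval_shiftOp_single (α : C →⋆ₐ[ℂ] C) (π : C →⋆ₙₐ[ℂ] (H →L[ℂ] H)) (p : ℕ × ℕ →₀ C)
    (a b : ℕ) (h : H) :
    symEval (orbitRep α π) (shiftOp H) p (lp.single 2 b h) a = π (symEntry α p a b) h := by
  simp only [symEval, symEntry, Finsupp.sum, map_sum, sum_apply, lp.coeFn_sum, Finset.sum_apply]
  refine Finset.sum_congr rfl fun k _ => ?_
  rw [mul_apply_eq_comp, mul_apply_eq_comp, shiftOp_pow_apply]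
  by_cases hk : k.1 ≤ a
  · rw [if_pos hk, orbitRep_apply, star_shiftOp_pow_apply]
    by_cases hb : a - k.1 + k.2 = b
    · rw [if_pos ⟨hk, hb⟩, ← hb, lp.single_apply_self]
    · rw [if_neg (fun h => hb h.2), lp.single_apply_ne _ _ _ hb]
      simp
  · rw [if_neg hk, if_neg (fun h => hk h.1)]
    simp

/-- The matrix over `C` on the right does not involve π except through its image, which makes
different representations comparable. -/
theorem trunc_symEval (α : C →⋆ₐ[ℂ] C) (π : C →⋆ₙₐ[ℂ] (H →L[ℂ] H)) (p : ℕ × ℕ →₀ C) (N : ℕ) :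
    trunc H N ∘L symEval (orbitRep α π) (shiftOp H) p ∘L adjoint (trunc H N) =
      matOp (Matrix.of fun a b => π (symEntry α p a b)) := by
  ext y a
  simp only [comp_apply, adjoint_trunc_apply, map_sum, WithLp.ofLp_sum, Finset.sum_apply,
    matOp_apply, Matrix.of_apply]
  exact Finset.sum_congr rfl fun b _ => symEval_shiftOp_single α π p a b (y b)

/-- Among the representations `∑ S^m π~(c) S*^n`, those with `π` faithful have the largest
norms. -/
theorem norm_matOp_symEval_shiftOp_le (α : C →⋆ₐ[ℂ] C) {K : Type*} [NormedAddCommGroup K]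
    [InnerProductSpace ℂ K] [CompleteSpace K] (σ : C →⋆ₙₐ[ℂ] (K →L[ℂ] K))
    {π : C →⋆ₙₐ[ℂ] (H →L[ℂ] H)} (hπ : Function.Injective π) {ν : ℕ}
    (p : Matrix (Fin ν) (Fin ν) (ℕ × ℕ →₀ C)) :
    ‖matOp (p.map (symEval (orbitRep α σ) (shiftOp K)))‖ ≤
      ‖matOp (p.map (symEval (orbitRep α π) (shiftOp H)))‖ := by
  refine norm_matOp_le_of_trunc _ fun N => ?_
  have h₁ := norm_matOp_compress_le (trunc H N) (adjoint (trunc H N)) (norm_trunc_le N)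
    (norm_adjoint_trunc_le N) (p.map (symEval (orbitRep α π) (shiftOp H)))
  refine le_trans ?_ h₁
  have h₂ := norm_matOp_matOp_le ν σ hπ N fun i j a b => symEntry α (p i j) a b
  have e₁ : (p.map (symEval (orbitRep α σ) (shiftOp K))).map
      (fun Y => trunc K N ∘L Y ∘L adjoint (trunc K N)) =
      Matrix.of fun i j => matOp (Matrix.of fun a b : Fin N => σ (symEntry α (p i j) a b)) := by
    ext1 i j
    exact trunc_symEval α σ (p i j) N
  have e₂ : (p.map (symEval (orbitRep α π) (shiftOp H))).map
      (fun Y => trunc H N ∘L Y ∘L adjoint (trunc H N)) =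
      Matrix.of fun i j => matOp (Matrix.of fun a b : Fin N => π (symEntry α (p i j) a b)) := by
    ext1 i j
    exact trunc_symEval α π (p i j) N
  rw [e₁, e₂]
  exact h₂

end Symbol

/-! ## The Poisson kernel of a strict contraction -/

section Poisson

variable {H : Type*} [NormedAddCommGroup H] [InnerProductSpace ℂ H] [CompleteSpace H]

/-- The defect operator `(1 - V V*)^{1/2}`. -/
def defect (V : H →L[ℂ] H) : H →L[ℂ] H := CFC.sqrt (1 - V * star V)

theorem star_defect (V : H →L[ℂ] H) : star (defect V) = defect V :=
  (IsSelfAdjoint.of_nonneg (CFC.sqrt_nonneg _)).star_eq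

theorem defect_mul_self {V : H →L[ℂ] H} (hV : ‖V‖ ≤ 1) :
    defect V * defect V = 1 - V * star V := by
  refine CFC.sqrt_mul_sqrt_self _ (sub_nonneg.2 ?_)
  rw [← CStarAlgebra.norm_le_one_iff_of_nonneg _ (mul_star_self_nonneg V),
    CStarRing.norm_self_mul_star]
  exact mul_le_one₀ hV (norm_nonneg V) hV

/-- This is ⟨D²x, x⟩ with D² = 1 - VV*. Evaluated at V*^n x, it gives the terms of a telescoping
sum. -/
theorem norm_defect_apply_sq {V : H →L[ℂ] H} (hV : ‖V‖ ≤ 1) (x : H) :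
    ‖defect V x‖ ^ 2 = ‖x‖ ^ 2 - ‖star V x‖ ^ 2 := by
  have h : inner ℂ (defect V x) (defect V x) = inner ℂ x x - inner ℂ (star V x) (star V x) := by
    nth_rw 1 [← star_defect V]
    rw [ContinuousLinearMap.star_eq_adjoint, adjoint_inner_left, ← mul_apply_eq_comp,
      defect_mul_self hV, ContinuousLinearMap.star_eq_adjoint, adjoint_inner_left]
    simp [inner_sub_right]
  simp only [inner_self_eq_norm_sq_to_K] at h
  exact_mod_cast h

theorem tendsto_star_pow_apply {V : H →L[ℂ] H} (hV : ‖V‖ < 1) (x : H) :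
    Tendsto (fun n => (star V ^ n) x) atTop (𝓝 0) := by
  have h : Tendsto (fun n => star V ^ n) atTop (𝓝 0) :=
    tendsto_pow_atTop_nhds_zero_of_norm_lt_one (by rwa [norm_star])
  have h' := ((ContinuousLinearMap.apply ℂ H x).continuous.tendsto 0).comp h
  rw [map_zero] at h'
  exact h'

/-- The partial sums telescope to ‖x‖² - ‖V*^N x‖². Strictness of the contraction makes the
remainder vanish, so that the Poisson kernel is isometric. -/
theorem hasSum_norm_defect_sq {V : H →L[ℂ] H} (hV : ‖V‖ < 1) (x : H) :
    HasSum (fun n => ‖defect V ((star V ^ n) x)‖ ^ 2) (‖x‖ ^ 2) := by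
  rw [hasSum_iff_tendsto_nat_of_nonneg fun n => sq_nonneg _]
  have h : ∀ N, ∑ n ∈ Finset.range N, ‖defect V ((star V ^ n) x)‖ ^ 2 =
      ‖x‖ ^ 2 - ‖(star V ^ N) x‖ ^ 2 := fun N => by
    simp_rw [norm_defect_apply_sq hV.le, ← mul_apply_eq_comp, ← pow_succ']
    rw [Finset.sum_range_sub' fun n => ‖(star V ^ n) x‖ ^ 2]
    simp
  simp_rw [h]
  simpa using ((tendsto_star_pow_apply hV x).norm.pow 2).const_sub (‖x‖ ^ 2)

/-- The Poisson kernel `x ↦ ((1 - V V*)^{1/2} V*^n x)ₙ` of a strict contraction `V`. -/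
def poisson {V : H →L[ℂ] H} (hV : ‖V‖ < 1) : H →ₗᵢ[ℂ] lp (fun _ : ℕ => H) 2 where
  toFun x := ⟨fun n => defect V ((star V ^ n) x), memℓp_gen (by
    simpa using (hasSum_norm_defect_sq hV x).summable)⟩
  map_add' x y := lp.ext (funext fun n => map_add (defect V ∘L (star V ^ n)) x y)
  map_smul' z x := lp.ext (funext fun n => map_smul (defect V ∘L (star V ^ n)) z x)
  norm_map' x := by
    have h := lp.hasSum_norm (p := 2) (by simp)
      (⟨fun n => defect V ((star V ^ n) x), memℓp_gen (by
        simpa using (hasSum_norm_defect_sq hV x).summable)⟩ : lp (fun _ : ℕ => H) 2)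
    simp only [ENNReal.toReal_ofNat, Real.rpow_two] at h
    exact (sq_eq_sq₀ (norm_nonneg _) (norm_nonneg _)).1 (h.unique (hasSum_norm_defect_sq hV x))

/-- The Poisson kernel as a bounded operator. -/
def poissonOp {V : H →L[ℂ] H} (hV : ‖V‖ < 1) : H →L[ℂ] lp (fun _ : ℕ => H) 2 :=
  (poisson hV).toContinuousLinearMap

variable {V : H →L[ℂ] H} (hV : ‖V‖ < 1)

theorem norm_poissonOp_le : ‖poissonOp hV‖ ≤ 1 := (poisson hV).norm_toContinuousLinearMap_le

theorem adjoint_poissonOp_comp : adjoint (poissonOp hV) ∘L poissonOp hV = 1 :=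
  (poisson hV).adjoint_comp_self

theorem star_shiftOp_comp_poissonOp :
    star (shiftOp H) ∘L poissonOp hV = poissonOp hV ∘L star V := by
  ext x n
  refine (star_shiftOp_apply _ n).trans ?_
  change defect V ((star V ^ (n + 1)) x) = defect V ((star V ^ n) (star V x))
  rw [pow_succ]
  rfl

theorem star_shiftOp_pow_comp_poissonOp (n : ℕ) :
    (star (shiftOp H) ^ n) ∘L poissonOp hV = poissonOp hV ∘L (star V ^ n) := by
  induction n with
  | zero => rfl
  | succ n ih =>
    calc (star (shiftOp H) ^ (n + 1)) ∘L poissonOp hV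
        = (star (shiftOp H) ^ n) ∘L (star (shiftOp H) ∘L poissonOp hV) := by
          rw [pow_succ]; rfl
      _ = ((star (shiftOp H) ^ n) ∘L poissonOp hV) ∘L star V := by
          rw [star_shiftOp_comp_poissonOp]; rfl
      _ = poissonOp hV ∘L (star V ^ (n + 1)) := by rw [ih, pow_succ]; rfl

theorem adjoint_poissonOp_comp_shiftOp_pow (n : ℕ) :
    adjoint (poissonOp hV) ∘L (shiftOp H ^ n) = (V ^ n) ∘L adjoint (poissonOp hV) := by
  have h := congrArg adjoint (star_shiftOp_pow_comp_poissonOp hV n)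
  rwa [adjoint_comp, adjoint_comp, ← star_pow, ← star_pow, ContinuousLinearMap.star_eq_adjoint,
    ContinuousLinearMap.star_eq_adjoint, adjoint_adjoint, adjoint_adjoint] at h

end Poisson

/-! ## The norm estimate -/

section Estimate

variable {C : Type u} [CStarAlgebra C] {α : C →⋆ₐ[ℂ] C} {H : Type*} [NormedAddCommGroup H]
  [InnerProductSpace ℂ H] [CompleteSpace H] {π : C →⋆ₙₐ[ℂ] (H →L[ℂ] H)} {V : H →L[ℂ] H}

/-- The adjoint of the covariance relation at c*. -/
theorem star_mul_rep (hcov : ∀ c, π c * V = V * π (α c)) (c : C) :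
    star V * π c = π (α c) * star V := by
  have h := congrArg star (hcov (star c))
  rwa [star_mul, star_mul, map_star, map_star, map_star, star_star, star_star] at h

theorem star_pow_mul_rep (hcov : ∀ c, π c * V = V * π (α c)) (n : ℕ) (c : C) :
    star V ^ n * π c = π ((α ^ n) c) * star V ^ n := by
  induction n generalizing c with
  | zero => rw [pow_zero, _root_.one_mul, _root_.mul_one, pow_zero_apply]
  | succ n ih =>
    rw [pow_succ, mul_assoc, star_mul_rep hcov, ← mul_assoc, ih, mul_assoc, pow_add_apply, pow_one]

/-- π(c)VV* = Vπ(α(c))V* = VV*π(c), and the functional calculus preserves commutation. -/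
theorem commute_defect (hcov : ∀ c, π c * V = V * π (α c)) (c : C) :
    Commute (defect V) (π c) := by
  refine Commute.cfcₙ_nnreal ?_ _
  refine (Commute.one_left _).sub_left ?_
  rw [Commute, SemiconjBy, mul_assoc, star_mul_rep hcov, ← mul_assoc, ← hcov, mul_assoc]

/-- In coordinate n, with D the defect operator: π(αⁿ(c)) D V*ⁿ = D π(αⁿ(c)) V*ⁿ = D V*ⁿ π(c). -/
theorem orbitRep_comp_poissonOp (hcov : ∀ c, π c * V = V * π (α c)) (hV : ‖V‖ < 1) (c : C) :
    orbitRep α π c ∘L poissonOp hV = poissonOp hV ∘L π c := by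
  ext x n
  change (π ((α ^ n) c) * defect V * star V ^ n) x = (defect V * (star V ^ n * π c)) x
  rw [star_pow_mul_rep hcov, ← mul_assoc, (commute_defect hcov _).eq]

/-- The kernel K intertwines S* with V*, and K* intertwines S with V. The order of the factors is
therefore essential: powers of S* meet K on the right, powers of S meet K* on the left, and K*K = 1
remains in the middle. -/
theorem poissonOp_compress_symEval (hcov : ∀ c, π c * V = V * π (α c)) (hV : ‖V‖ < 1)
    (p : ℕ × ℕ →₀ C) :
    adjoint (poissonOp hV) ∘L symEval (orbitRep α π) (shiftOp H) p ∘L poissonOp hV =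
      symEval π V p := by
  simp only [symEval, Finsupp.sum, ContinuousLinearMap.finsetSum_comp,
    ContinuousLinearMap.comp_finsetSum]
  refine Finset.sum_congr rfl fun k _ => ?_
  calc adjoint (poissonOp hV) ∘L
        (shiftOp H ^ k.1 * orbitRep α π (p k) * star (shiftOp H) ^ k.2) ∘L poissonOp hV
      = (adjoint (poissonOp hV) ∘L (shiftOp H ^ k.1)) ∘L orbitRep α π (p k) ∘L
          ((star (shiftOp H) ^ k.2) ∘L poissonOp hV) := rfl
    _ = (V ^ k.1) ∘L adjoint (poissonOp hV) ∘L (orbitRep α π (p k) ∘L poissonOp hV) ∘L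
          (star V ^ k.2) := by
        rw [adjoint_poissonOp_comp_shiftOp_pow, star_shiftOp_pow_comp_poissonOp]; rfl
    _ = (V ^ k.1) ∘L (adjoint (poissonOp hV) ∘L poissonOp hV) ∘L π (p k) ∘L (star V ^ k.2) := by
        rw [orbitRep_comp_poissonOp hcov]; rfl
    _ = V ^ k.1 * π (p k) * star V ^ k.2 := by rw [adjoint_poissonOp_comp]; rfl

theorem continuous_symEval (π : C →⋆ₙₐ[ℂ] (H →L[ℂ] H)) (p : ℕ × ℕ →₀ C) :
    Continuous fun V : H →L[ℂ] H => symEval π V p :=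
  continuous_finsetSum _ fun k _ => ((continuous_id.pow k.1).mul continuous_const).mul
    (continuous_star.pow k.2)

/-- The pair `(π₀~, S)` built from a faithful representation `π₀` dominates every left covariant
contractive pair on matrices over the span of the operators `V^m π(c) V*^n`. -/
theorem norm_matOp_symEval_le (hcov : ∀ c, π c * V = V * π (α c)) (hV : ‖V‖ ≤ 1)
    {H₀ : Type*} [NormedAddCommGroup H₀] [InnerProductSpace ℂ H₀] [CompleteSpace H₀]
    {π₀ : C →⋆ₙₐ[ℂ] (H₀ →L[ℂ] H₀)} (hπ₀ : Function.Injective π₀) {ν : ℕ}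
    (p : Matrix (Fin ν) (Fin ν) (ℕ × ℕ →₀ C)) :
    ‖matOp (p.map (symEval π V))‖ ≤
      ‖matOp (p.map (symEval (orbitRep α π₀) (shiftOp H₀)))‖ := by
  have key : ∀ r : ℝ, r ∈ Set.Ico 0 1 → ‖matOp (p.map (symEval π ((r : ℂ) • V)))‖ ≤
      ‖matOp (p.map (symEval (orbitRep α π₀) (shiftOp H₀)))‖ := by
    intro r hr
    have hcov' : ∀ c, π c * ((r : ℂ) • V) = ((r : ℂ) • V) * π (α c) := fun c => by
      rw [mul_smul_comm, smul_mul_assoc, hcov]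
    have hrV : ‖(r : ℂ) • V‖ < 1 := by
      rw [norm_smul, Complex.norm_real, Real.norm_of_nonneg hr.1]
      exact (mul_le_of_le_one_right hr.1 hV).trans_lt hr.2
    -- The pair (π~, S) built from the given π stands between: it dilates (π, rV) and is dominated
    -- by the faithful model.
    refine le_trans ?_ (norm_matOp_symEval_shiftOp_le α π hπ₀ p)
    have h := norm_matOp_compress_le (adjoint (poissonOp hrV)) (poissonOp hrV)
      ((LinearIsometryEquiv.norm_map _ _).trans_le (norm_poissonOp_le hrV))
      (norm_poissonOp_le hrV) (p.map (symEval (orbitRep α π) (shiftOp H)))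
    rwa [Matrix.map_map, funext (f := _ ∘ _) (poissonOp_compress_symEval hcov' hrV)] at h
  have hlim : Tendsto (fun r : ℝ => ‖matOp (p.map (symEval π ((r : ℂ) • V)))‖) (𝓝[<] 1)
      (𝓝 ‖matOp (p.map (symEval π V))‖) := by
    refine tendsto_norm_matOp fun i j => ?_
    have h : Continuous fun r : ℝ => symEval π ((r : ℂ) • V) (p i j) :=
      (continuous_symEval π (p i j)).comp (Complex.continuous_ofReal.smul continuous_const)
    simpa using (h.tendsto 1).mono_left nhdsWithin_le_nhds
  exact le_of_tendsto hlim (mem_of_superset (Ico_mem_nhdsLT zero_lt_one) key)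

end Estimate

/-! ## Integrated forms -/

section SymEval

variable {C : Type u} [CStarAlgebra C] {H : Type*} [NormedAddCommGroup H] [InnerProductSpace ℂ H]
  [CompleteSpace H] (π : C →⋆ₙₐ[ℂ] (H →L[ℂ] H)) (V : H →L[ℂ] H)

theorem symEval_single (k : ℕ × ℕ) (c : C) :
    symEval π V (Finsupp.single k c) = V ^ k.1 * π c * star V ^ k.2 :=
  Finsupp.sum_single_index (by simp)

theorem symEval_zero : symEval π V 0 = 0 := Finsupp.sum_zero_index

theorem symEval_add (p q : ℕ × ℕ →₀ C) :
    symEval π V (p + q) = symEval π V p + symEval π V q :=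
  Finsupp.sum_add_index' (fun _ => by simp) fun _ _ _ => by rw [map_add, mul_add, add_mul]

theorem symEval_sum {ι : Type*} (s : Finset ι) (p : ι → ℕ × ℕ →₀ C) :
    symEval π V (∑ i ∈ s, p i) = ∑ i ∈ s, symEval π V (p i) :=
  map_sum (AddMonoidHom.mk' (symEval π V) (symEval_add π V)) p s

end SymEval

section Integrated

variable {C : Type u} [CStarAlgebra C] {α : C →⋆ₐ[ℂ] C}

/-- The noncommutative polynomial `∑_{n < K} V^n F(n)`. -/
def L1.partialSymbol (F : L1 α) (K : ℕ) : ℕ × ℕ →₀ C :=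
  ∑ n ∈ Finset.range K, Finsupp.single (n, 0) (F n)

namespace LeftCovariantPair

variable (P : LeftCovariantPair.{u, w} α)

theorem symEval_partialSymbol (F : L1 α) (K : ℕ) :
    symEval P.π P.V (F.partialSymbol K) = ∑ n ∈ Finset.range K, P.V ^ n * P.π (F n) := by
  rw [L1.partialSymbol, symEval_sum]
  exact Finset.sum_congr rfl fun n _ => by rw [symEval_single, pow_zero, _root_.mul_one]

theorem tendsto_sum_integrated (F : L1 α) :
    Tendsto (fun K => ∑ n ∈ Finset.range K, P.V ^ n * P.π (F n)) atTop (𝓝 (P.integrated F)) :=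
  (P.summable_norm_term F).of_norm.hasSum.tendsto_sum_nat

theorem integrated_single (n : ℕ) (c : C) :
    P.integrated (L1.single α n c) = P.V ^ n * P.π c := by
  rw [integrated_apply, tsum_eq_single n]
  · simp
  · intro m hm
    simp [hm]

theorem polynomials_subset_range_gen : P.polynomials ⊆ Set.range P.gen := by
  rintro x ⟨k, c, hx⟩
  refine ⟨∑ n ∈ Finset.range (k + 1), L1.single α n (c n), Subtype.ext ?_⟩
  rw [hx]
  exact (map_sum P.integrated _ _).trans
    (Finset.sum_congr rfl fun n _ => P.integrated_single n (c n))

theorem gen_mem_closure_polynomials (F : L1 α) : P.gen F ∈ closure P.polynomials := by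
  have hmem : ∀ K, ∑ n ∈ Finset.range (K + 1), P.V ^ n * P.π (F n) ∈ P.cstar := fun K =>
    sum_mem fun n _ => by
      rw [← P.integrated_single n (F n)]
      exact (P.gen (L1.single α n (F n))).2
  refine mem_closure_of_tendsto
    (f := fun K => (⟨∑ n ∈ Finset.range (K + 1), P.V ^ n * P.π (F n), hmem K⟩ : P.cstar))
    -- A polynomial of degree k has k + 1 terms, hence the shift of the index by one.
    (tendsto_subtype_rng.2 ((tendsto_add_atTop_iff_nat 1).2 (P.tendsto_sum_integrated F)))
    (Eventually.of_forall fun K => ⟨K, fun n => F n, rfl⟩)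

theorem closure_range_gen : closure (Set.range P.gen) = closure P.polynomials :=
  (closure_minimal (by rintro _ ⟨F, rfl⟩; exact P.gen_mem_closure_polynomials F)
    isClosed_closure).antisymm (closure_mono P.polynomials_subset_range_gen)

/-- Closedness makes `P.cstar` a C*-algebra, so *-homomorphisms out of it are automatically
contractive. -/
instance : IsClosed (P.cstar : Set (P.H →L[ℂ] P.H)) :=
  NonUnitalStarSubalgebra.isClosed_topologicalClosure _

end LeftCovariantPair

theorem LeftCovariantPair.tendsto_norm_matOp_partialSymbol (P : LeftCovariantPair.{u, w} α)
    {ν : ℕ} (F : Matrix (Fin ν) (Fin ν) (L1 α)) :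
    Tendsto (fun K : ℕ => ‖matOp ((F.map fun G => G.partialSymbol K).map (symEval P.π P.V))‖)
      atTop (𝓝 ‖matOp (F.map P.integrated)‖) := by
  refine tendsto_norm_matOp fun i j => ?_
  simp only [Matrix.map_apply, P.symEval_partialSymbol]
  exact P.tendsto_sum_integrated (F i j)

/-- `shiftPair` unfolds to `orbitRep` and `shiftOp`. The universes of `P` and `H₀` are independent,
so that the universal pair, which lives in a larger universe, is covered. -/
theorem norm_matOp_symEval_le_shiftPair (P : LeftCovariantPair.{u, w} α) {H₀ : Type*}
    [NormedAddCommGroup H₀] [InnerProductSpace ℂ H₀] [CompleteSpace H₀]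
    {π : C →⋆ₙₐ[ℂ] (H₀ →L[ℂ] H₀)} (hπ : Function.Injective π) {ν : ℕ}
    (p : Matrix (Fin ν) (Fin ν) (ℕ × ℕ →₀ C)) :
    ‖matOp (p.map (symEval P.π P.V))‖ ≤
      ‖matOp (p.map (symEval (shiftPair α π).π (shiftPair α π).V))‖ :=
  norm_matOp_symEval_le P.covariant P.norm_V_le hπ p

theorem norm_matOp_integrated_le (P : LeftCovariantPair.{u, w} α) {H₀ : Type*}
    [NormedAddCommGroup H₀] [InnerProductSpace ℂ H₀] [CompleteSpace H₀]
    {π : C →⋆ₙₐ[ℂ] (H₀ →L[ℂ] H₀)} (hπ : Function.Injective π) {ν : ℕ}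
    (F : Matrix (Fin ν) (Fin ν) (L1 α)) :
    ‖matOp (F.map P.integrated)‖ ≤ ‖matOp (F.map (shiftPair α π).integrated)‖ :=
  le_of_tendsto_of_tendsto' (P.tendsto_norm_matOp_partialSymbol F)
    ((shiftPair α π).tendsto_norm_matOp_partialSymbol F) fun K =>
      norm_matOp_symEval_le_shiftPair P hπ (F.map fun G => G.partialSymbol K)

end Integrated

/-! ## Enveloping algebras with a dominating representation -/

namespace Enveloping

variable {B : Type u} [NormedRing B] [NormedAlgebra ℂ B] (𝓕 : Set (ContractiveRep.{u, w} B))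

theorem continuous_extend (ρ : 𝓕) : Continuous (Enveloping.extend 𝓕 ρ) :=
  UniformSpace.Completion.continuous_extension

theorem denseRange_of : DenseRange (Enveloping.of 𝓕) :=
  UniformSpace.Completion.denseRange_coe (α := PreEnveloping 𝓕)

/-- The extension of `ρ ∈ 𝓕` to the enveloping algebra, as a homomorphism. -/
def extendHom (ρ : 𝓕) : Enveloping 𝓕 →ₙₐ[ℂ] (ρ.1.H →L[ℂ] ρ.1.H) where
  toFun := Enveloping.extend 𝓕 ρ
  map_smul' z x := by
    refine (denseRange_of 𝓕).induction_on (p := fun x => Enveloping.extend 𝓕 ρ (z • x) =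
      z • Enveloping.extend 𝓕 ρ x) x (isClosed_eq ((continuous_extend 𝓕 ρ).comp
        (continuous_const_smul z)) ((continuous_extend 𝓕 ρ).const_smul z)) fun b => ?_
    rw [← map_smul, extend_of, extend_of, map_smul]
  map_zero' := by rw [← map_zero (Enveloping.of 𝓕), extend_of, map_zero]
  map_add' x y := by
    refine (denseRange_of 𝓕).induction_on₂ (p := fun x y => Enveloping.extend 𝓕 ρ (x + y) =
      Enveloping.extend 𝓕 ρ x + Enveloping.extend 𝓕 ρ y) (isClosed_eq
        ((continuous_extend 𝓕 ρ).comp continuous_add)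
        (((continuous_extend 𝓕 ρ).comp continuous_fst).add
          ((continuous_extend 𝓕 ρ).comp continuous_snd))) (fun a b => ?_) x y
    rw [← map_add, extend_of, extend_of, extend_of, map_add]
  map_mul' x y := by
    refine (denseRange_of 𝓕).induction_on₂ (p := fun x y => Enveloping.extend 𝓕 ρ (x * y) =
      Enveloping.extend 𝓕 ρ x * Enveloping.extend 𝓕 ρ y) (isClosed_eq
        ((continuous_extend 𝓕 ρ).comp continuous_mul)
        (((continuous_extend 𝓕 ρ).comp continuous_fst).mul
          ((continuous_extend 𝓕 ρ).comp continuous_snd))) (fun a b => ?_) x y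
    rw [← map_mul, extend_of, extend_of, extend_of, map_mul]

variable {𝓕} {ρ₀ : 𝓕} (hρ₀ : ∀ (ρ : 𝓕) (ν : ℕ) (F : Matrix (Fin ν) (Fin ν) B),
  ‖matOp (F.map ρ.1.ρ)‖ ≤ ‖matOp (F.map ρ₀.1.ρ)‖)

include hρ₀

theorem norm_matOp_extend_le (ρ : 𝓕) {ν : ℕ} (a : Matrix (Fin ν) (Fin ν) (Enveloping 𝓕)) :
    ‖matOp (a.map (Enveloping.extend 𝓕 ρ))‖ ≤ ‖matOp (a.map (Enveloping.extend 𝓕 ρ₀))‖ := by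
  have hcont (ρ : 𝓕) : Continuous fun a : Fin ν → Fin ν → Enveloping 𝓕 =>
      ‖matOp (Matrix.map (Matrix.of a) (Enveloping.extend 𝓕 ρ))‖ :=
    continuous_iff_continuousAt.2 fun a₀ => tendsto_norm_matOp fun i j =>
      ((continuous_extend 𝓕 ρ).comp ((continuous_apply j).comp (continuous_apply i))).tendsto a₀
  -- Matrices with entries from the image of `B` are dense, and both sides of the inequality are
  -- continuous in the matrix.
  have hdense : DenseRange (Pi.map fun _ : Fin ν => Pi.map fun _ : Fin ν => Enveloping.of 𝓕) :=
    DenseRange.piMap fun _ => DenseRange.piMap fun _ => denseRange_of 𝓕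
  refine hdense.induction_on (p := fun a : Fin ν → Fin ν → Enveloping 𝓕 =>
    ‖matOp (Matrix.map (Matrix.of a) (Enveloping.extend 𝓕 ρ))‖ ≤
      ‖matOp (Matrix.map (Matrix.of a) (Enveloping.extend 𝓕 ρ₀))‖) a
    (isClosed_le (hcont ρ) (hcont ρ₀)) fun F => ?_
  have e (ρ : 𝓕) : Matrix.map (Matrix.of
      ((Pi.map fun _ : Fin ν => Pi.map fun _ : Fin ν => Enveloping.of 𝓕) F))
        (Enveloping.extend 𝓕 ρ) = (Matrix.of F).map ρ.1.ρ := by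
    ext1 i j
    exact extend_of 𝓕 ρ (F i j)
  rw [e, e]
  exact hρ₀ ρ ν (Matrix.of F)

theorem matrixNorm_eq {ν : ℕ} (a : Matrix (Fin ν) (Fin ν) (Enveloping 𝓕)) :
    Enveloping.matrixNorm 𝓕 a = ‖matOp (a.map (Enveloping.extend 𝓕 ρ₀))‖ := by
  have : Nonempty 𝓕 := ⟨ρ₀⟩
  have h (ρ : 𝓕) := norm_matOp_extend_le hρ₀ ρ a
  -- Domination by ρ₀ also bounds the family above; without a bound the real supremum would default
  -- to 0.
  exact le_antisymm (ciSup_le h) (le_ciSup (f := fun ρ : 𝓕 =>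
    ‖matOp (a.map (Enveloping.extend 𝓕 ρ))‖) ⟨_, by rintro _ ⟨ρ, rfl⟩; exact h ρ⟩ ρ₀)

/-- On the image of `B` the norm is ω₁, a supremum attained at ρ₀ by the case ν = 1 of domination;
density does the rest. -/
theorem norm_extend_eq (x : Enveloping 𝓕) : ‖Enveloping.extend 𝓕 ρ₀ x‖ = ‖x‖ := by
  refine (denseRange_of 𝓕).induction_on (p := fun x => ‖Enveloping.extend 𝓕 ρ₀ x‖ = ‖x‖) x
    (isClosed_eq (continuous_extend 𝓕 ρ₀).norm continuous_norm) fun b => ?_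
  have : Nonempty 𝓕 := ⟨ρ₀⟩
  rw [extend_of]
  refine Eq.trans ?_ (UniformSpace.Completion.norm_coe _).symm
  refine le_antisymm (norm_le_omega 𝓕 ρ₀ b) (ciSup_le fun ρ => ?_)
  have h := hρ₀ ρ 1 (Matrix.of fun _ _ => b)
  rwa [norm_matOp_one, norm_matOp_one] at h

end Enveloping

/-! ## Realization of enveloping algebras inside `C*(π, V)` -/

section Realization

variable {C : Type u} [CStarAlgebra C] {α : C →⋆ₐ[ℂ] C}

/-- If the integrated form of `P₀` belongs to `𝓕` and dominates all representations in `𝓕`, then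
the enveloping algebra is completely isometric to the closure of the polynomials in
`C*(P₀)`. -/
theorem exists_realization {𝓕 : Set (ContractiveRep.{u, w} (L1 α))}
    {P₀ : LeftCovariantPair.{u, w} α} (hmem : P₀.toRep ∈ 𝓕)
    (hdom : ∀ ρ ∈ 𝓕, ∀ (ν : ℕ) (F : Matrix (Fin ν) (Fin ν) (L1 α)),
      ‖matOp (F.map ρ.ρ)‖ ≤ ‖matOp (F.map P₀.integrated)‖) :
    ∃ Ψ : Enveloping 𝓕 →ₙₐ[ℂ] P₀.cstar,
      Function.Injective Ψ ∧
      (∀ F, Ψ (Enveloping.of _ F) = P₀.gen F) ∧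
      Set.range Ψ = closure P₀.polynomials ∧
      ∀ (ν : ℕ) (a : Matrix (Fin ν) (Fin ν) (Enveloping 𝓕)),
        ‖matOp (a.map fun x => (Ψ x).1)‖ = Enveloping.matrixNorm _ a := by
  let ρ₀ : 𝓕 := ⟨P₀.toRep, hmem⟩
  have hρ₀ : ∀ (ρ : 𝓕) (ν : ℕ) (F : Matrix (Fin ν) (Fin ν) (L1 α)),
      ‖matOp (F.map ρ.1.ρ)‖ ≤ ‖matOp (F.map ρ₀.1.ρ)‖ := fun ρ => hdom ρ.1 ρ.2
  let E : Enveloping 𝓕 →ₙₐ[ℂ] (P₀.H →L[ℂ] P₀.H) := Enveloping.extendHom 𝓕 ρ₀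
  have hE : Continuous E := Enveloping.continuous_extend 𝓕 ρ₀
  have hof (F : L1 α) : E (Enveloping.of 𝓕 F) = P₀.integrated F := Enveloping.extend_of 𝓕 ρ₀ F
  have hcstar (x : Enveloping 𝓕) : E x ∈ P₀.cstar := by
    refine (Enveloping.denseRange_of 𝓕).induction_on (p := fun x => E x ∈ P₀.cstar) x
      (IsClosed.preimage hE (NonUnitalStarSubalgebra.isClosed_topologicalClosure _)) fun F => ?_
    rw [hof]
    exact (P₀.gen F).2
  let Ψ : Enveloping 𝓕 →ₙₐ[ℂ] P₀.cstar :=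
    { toFun := fun x => ⟨E x, hcstar x⟩
      map_smul' := fun z x => Subtype.ext (map_smul E z x)
      map_zero' := Subtype.ext (map_zero E)
      map_add' := fun x y => Subtype.ext (map_add E x y)
      map_mul' := fun x y => Subtype.ext (map_mul E x y) }
  have hgen (F : L1 α) : Ψ (Enveloping.of _ F) = P₀.gen F := Subtype.ext (hof F)
  have hiso : Isometry Ψ :=
    AddMonoidHomClass.isometry_of_norm Ψ fun x => Enveloping.norm_extend_eq hρ₀ x
  refine ⟨Ψ, hiso.injective, hgen, ?_, fun ν a => (Enveloping.matrixNorm_eq hρ₀ a).symm⟩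
  rw [← P₀.closure_range_gen]
  -- The enveloping algebra is complete, so its isometric image is closed.
  refine Set.Subset.antisymm ?_ (closure_minimal ?_ hiso.isClosedEmbedding.isClosed_range)
  · rintro _ ⟨x, rfl⟩
    refine (Enveloping.denseRange_of 𝓕).induction_on
      (p := fun x => Ψ x ∈ closure (Set.range P₀.gen)) x
      (isClosed_closure.preimage hiso.continuous) fun F => ?_
    rw [hgen]
    exact subset_closure ⟨F, rfl⟩
  · rintro _ ⟨F, rfl⟩
    exact ⟨_, hgen F⟩

end Realization

/-- Two unital algebras embedded with the same range, and the same image of the unit, are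
isomorphic over the embeddings. -/
theorem exists_algEquiv_of_range_eq {E₁ E₂ A : Type*} [Ring E₁] [Algebra ℂ E₁] [Ring E₂]
    [Algebra ℂ E₂] [NonUnitalRing A] [Module ℂ A] {Ψ₁ : E₁ →ₙₐ[ℂ] A} {Ψ₂ : E₂ →ₙₐ[ℂ] A}
    (h₁ : Function.Injective Ψ₁) (h₂ : Function.Injective Ψ₂)
    (hrange : Set.range Ψ₁ = Set.range Ψ₂) (hone : Ψ₁ 1 = Ψ₂ 1) :
    ∃ Θ : E₁ ≃ₐ[ℂ] E₂, ∀ x, Ψ₂ (Θ x) = Ψ₁ x := by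
  have hex (x : E₁) : ∃ y, Ψ₂ y = Ψ₁ x := by
    have : Ψ₁ x ∈ Set.range Ψ₂ := hrange ▸ ⟨x, rfl⟩
    exact this
  choose f hf using hex
  let fl : E₁ →ₗ[ℂ] E₂ :=
    { toFun := f
      map_add' := fun x y => h₂ (by simp only [map_add, hf])
      map_smul' := fun z x => h₂ (by simp only [map_smul, hf, RingHom.id_apply]) }
  let fa : E₁ →ₐ[ℂ] E₂ := AlgHom.ofLinearMap fl (h₂ ((hf 1).trans hone))
    fun x y => h₂ ((hf _).trans (by rw [map_mul, map_mul]; exact congrArg₂ _ (hf x).symm (hf y).symm))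
  refine ⟨AlgEquiv.ofBijective fa ⟨fun x y hxy => h₁ ?_, fun y => ?_⟩, hf⟩
  · rw [← hf x, ← hf y]
    exact congrArg Ψ₂ hxy
  · have : Ψ₂ y ∈ Set.range Ψ₁ := hrange ▸ ⟨y, rfl⟩
    obtain ⟨x, hx⟩ := this
    exact ⟨x, h₂ ((hf x).trans hx)⟩

/-! ## Generated C*-algebras -/

section Compression

/-- Compression of a generated C*-algebra to a reducing subspace is a *-homomorphism. -/
theorem exists_compression {K L : Type*} [NormedAddCommGroup K] [InnerProductSpace ℂ K]
    [CompleteSpace K] [NormedAddCommGroup L] [InnerProductSpace ℂ L] [CompleteSpace L]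
    {j : L →L[ℂ] K} (hj : adjoint j ∘L j = 1) {s : Set (K →L[ℂ] K)}
    {𝓑 : NonUnitalStarSubalgebra ℂ (L →L[ℂ] L)} (h𝓑 : IsClosed (𝓑 : Set (L →L[ℂ] L)))
    (hs : ∀ Y ∈ s, Commute Y (j ∘L adjoint j)) (hs' : ∀ Y ∈ s, adjoint j ∘L Y ∘L j ∈ 𝓑) :
    ∃ Φ : (NonUnitalStarAlgebra.adjoin ℂ s).topologicalClosure →⋆ₙₐ[ℂ] 𝓑,
      ∀ Y, (Φ Y : L →L[ℂ] L) = adjoint j ∘L (Y : K →L[ℂ] K) ∘L j := by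
  have hje : (j ∘L adjoint j) ∘L j = j := by
    rw [ContinuousLinearMap.comp_assoc, hj]; rfl
  -- With e = jj*, one has j = ej, and e moves past Z to separate the two compressions.
  have hmul (Y Z : K →L[ℂ] K) (hZ : Commute Z (j ∘L adjoint j)) :
      adjoint j ∘L (Y * Z) ∘L j = (adjoint j ∘L Y ∘L j) * (adjoint j ∘L Z ∘L j) :=
    calc adjoint j ∘L (Y * Z) ∘L j = adjoint j ∘L Y ∘L Z ∘L ((j ∘L adjoint j) ∘L j) := by
          rw [hje]; rfl
      _ = adjoint j ∘L Y ∘L (Z * (j ∘L adjoint j)) ∘L j := rfl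
      _ = adjoint j ∘L Y ∘L ((j ∘L adjoint j) * Z) ∘L j := by rw [hZ.eq]
      _ = (adjoint j ∘L Y ∘L j) * (adjoint j ∘L Z ∘L j) := rfl
  have hstar (Y : K →L[ℂ] K) : adjoint j ∘L star Y ∘L j = star (adjoint j ∘L Y ∘L j) := by
    simp only [ContinuousLinearMap.star_eq_adjoint, adjoint_comp, adjoint_adjoint]
    rfl
  have hself : star (j ∘L adjoint j) = j ∘L adjoint j := by
    rw [ContinuousLinearMap.star_eq_adjoint, adjoint_comp, adjoint_adjoint]
  -- Both conditions go through the induction together, since compressing a product uses commutation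
  -- of the second factor with jj*.
  have hadj : ∀ Y ∈ NonUnitalStarAlgebra.adjoin ℂ s,
      Commute Y (j ∘L adjoint j) ∧ adjoint j ∘L Y ∘L j ∈ 𝓑 := by
    intro Y hY
    induction hY using NonUnitalStarAlgebra.adjoin_induction with
    | mem Y hY => exact ⟨hs Y hY, hs' Y hY⟩
    | add Y Z _ _ hY hZ =>
      refine ⟨hY.1.add_left hZ.1, ?_⟩
      rw [ContinuousLinearMap.add_comp, ContinuousLinearMap.comp_add]
      exact add_mem hY.2 hZ.2
    | zero =>
      refine ⟨Commute.zero_left _, ?_⟩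
      rw [ContinuousLinearMap.zero_comp, ContinuousLinearMap.comp_zero]
      exact zero_mem _
    | mul Y Z _ _ hY hZ =>
      refine ⟨hY.1.mul_left hZ.1, ?_⟩
      rw [hmul Y Z hZ.1]
      exact mul_mem hY.2 hZ.2
    | smul z Y _ hY =>
      refine ⟨hY.1.smul_left z, ?_⟩
      rw [ContinuousLinearMap.smul_comp, ContinuousLinearMap.comp_smul]
      exact SMulMemClass.smul_mem z hY.2
    | star Y _ hY =>
      refine ⟨hself ▸ hY.1.star_star, ?_⟩
      rw [hstar]
      exact star_mem hY.2
  have hcont : Continuous fun Y : K →L[ℂ] K => adjoint j ∘L Y ∘L j :=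
    continuous_const.clm_comp (continuous_id.clm_comp continuous_const)
  have hcl : ∀ Y ∈ (NonUnitalStarAlgebra.adjoin ℂ s).topologicalClosure,
      Commute Y (j ∘L adjoint j) ∧ adjoint j ∘L Y ∘L j ∈ 𝓑 := fun Y hY =>
    closure_minimal (t := {Y | Commute Y (j ∘L adjoint j) ∧ adjoint j ∘L Y ∘L j ∈ 𝓑}) hadj
      ((isClosed_eq (continuous_id.mul continuous_const)
        (continuous_const.mul continuous_id)).inter (h𝓑.preimage hcont)) hY
  exact ⟨{
    toFun := fun Y => ⟨adjoint j ∘L (Y : K →L[ℂ] K) ∘L j, (hcl Y Y.2).2⟩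
    map_smul' := fun z Y => Subtype.ext (by
      change adjoint j ∘L (z • (Y : K →L[ℂ] K)) ∘L j = z • (adjoint j ∘L (Y : K →L[ℂ] K) ∘L j)
      rw [ContinuousLinearMap.smul_comp, ContinuousLinearMap.comp_smul])
    map_zero' := Subtype.ext (by
      change adjoint j ∘L (0 : K →L[ℂ] K) ∘L j = 0
      rw [ContinuousLinearMap.zero_comp, ContinuousLinearMap.comp_zero])
    map_add' := fun Y Z => Subtype.ext (by
      change adjoint j ∘L (Y.1 + Z.1) ∘L j =
        adjoint j ∘L (Y : K →L[ℂ] K) ∘L j + adjoint j ∘L (Z : K →L[ℂ] K) ∘L j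
      rw [ContinuousLinearMap.add_comp, ContinuousLinearMap.comp_add])
    map_mul' := fun Y Z => Subtype.ext (hmul Y Z (hcl Z Z.2).1)
    map_star' := fun Y => Subtype.ext (hstar Y) }, fun Y => rfl⟩

end Compression

namespace LeftCovariantPair

variable {C : Type u} [CStarAlgebra C] {α : C →⋆ₐ[ℂ] C} {P : LeftCovariantPair.{u, w} α}

theorem IsIsometric.star_mul_self (hP : P.IsIsometric) : star P.V * P.V = 1 :=
  (isometry_iff_adjoint_comp_self P.V).1 hP

theorem IsIsometric.star_pow_mul_pow (hP : P.IsIsometric) (n : ℕ) :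
    star P.V ^ n * P.V ^ n = 1 := by
  induction n with
  | zero => simp
  | succ n ih =>
    rw [pow_succ, pow_succ', mul_assoc, ← mul_assoc (star P.V), hP.star_mul_self,
      _root_.one_mul, ih]

/-- Since V*V = 1, the inner product V*^{k₂} V^{l₁} collapses to a power of V or of V*, according to
which exponent is larger. Covariance then moves that power outward past π. -/
theorem IsIsometric.exists_symEval_mul_single (hP : P.IsIsometric) (k l : ℕ × ℕ) (c d : C) :
    ∃ r, P.V ^ k.1 * P.π c * star P.V ^ k.2 * (P.V ^ l.1 * P.π d * star P.V ^ l.2) =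
      symEval P.π P.V r := by
  rcases le_total k.2 l.1 with h | h
  · obtain ⟨m, hm⟩ := Nat.exists_eq_add_of_le h
    refine ⟨Finsupp.single (k.1 + m, l.2) ((α ^ m) c * d), ?_⟩
    rw [symEval_single, hm, pow_add, pow_add, map_mul]
    calc P.V ^ k.1 * P.π c * star P.V ^ k.2 *
          (P.V ^ k.2 * P.V ^ m * P.π d * star P.V ^ l.2)
        = P.V ^ k.1 * P.π c * (star P.V ^ k.2 * P.V ^ k.2) *
          (P.V ^ m * P.π d * star P.V ^ l.2) := by simp only [mul_assoc]
      _ = P.V ^ k.1 * (P.π c * P.V ^ m) * P.π d * star P.V ^ l.2 := by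
          rw [hP.star_pow_mul_pow, _root_.mul_one]; simp only [mul_assoc]
      _ = P.V ^ k.1 * P.V ^ m * (P.π ((α ^ m) c) * P.π d) * star P.V ^ l.2 := by
          rw [P.covariant_pow]; simp only [mul_assoc]
  · obtain ⟨m, hm⟩ := Nat.exists_eq_add_of_le' h
    refine ⟨Finsupp.single (k.1, m + l.2) (c * (α ^ m) d), ?_⟩
    rw [symEval_single, hm, pow_add, pow_add, map_mul]
    calc P.V ^ k.1 * P.π c * (star P.V ^ m * star P.V ^ l.1) *
          (P.V ^ l.1 * P.π d * star P.V ^ l.2)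
        = P.V ^ k.1 * P.π c * star P.V ^ m * (star P.V ^ l.1 * P.V ^ l.1) *
          (P.π d * star P.V ^ l.2) := by simp only [mul_assoc]
      _ = P.V ^ k.1 * P.π c * (star P.V ^ m * P.π d) * star P.V ^ l.2 := by
          rw [hP.star_pow_mul_pow, _root_.mul_one]; simp only [mul_assoc]
      _ = P.V ^ k.1 * (P.π c * P.π ((α ^ m) d)) * (star P.V ^ m * star P.V ^ l.2) := by
          rw [star_pow_mul_rep P.covariant]; simp only [mul_assoc]

theorem IsIsometric.exists_symEval_mul (hP : P.IsIsometric) (p q : ℕ × ℕ →₀ C) :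
    ∃ r, symEval P.π P.V p * symEval P.π P.V q = symEval P.π P.V r := by
  induction p using Finsupp.induction_linear with
  | zero => exact ⟨0, by rw [symEval_zero, zero_mul]⟩
  | add p₁ p₂ h₁ h₂ =>
    obtain ⟨r₁, h₁⟩ := h₁
    obtain ⟨r₂, h₂⟩ := h₂
    exact ⟨r₁ + r₂, by rw [symEval_add, symEval_add, add_mul, h₁, h₂]⟩
  | single k c =>
    induction q using Finsupp.induction_linear with
    | zero => exact ⟨0, by rw [symEval_zero, mul_zero]⟩
    | add q₁ q₂ h₁ h₂ =>
      obtain ⟨r₁, h₁⟩ := h₁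
      obtain ⟨r₂, h₂⟩ := h₂
      exact ⟨r₁ + r₂, by rw [symEval_add, symEval_add, mul_add, h₁, h₂]⟩
    | single l d =>
      rw [symEval_single, symEval_single]
      exact hP.exists_symEval_mul_single k l c d

/-- For an isometric pair, the operators `∑ V^m π(c) V*^n` form a *-algebra. -/
def normallyOrdered (hP : P.IsIsometric) : NonUnitalStarSubalgebra ℂ (P.H →L[ℂ] P.H) where
  carrier := Set.range (symEval P.π P.V)
  add_mem' := by
    rintro _ _ ⟨p, rfl⟩ ⟨q, rfl⟩
    exact ⟨p + q, symEval_add _ _ _ _⟩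
  zero_mem' := ⟨0, symEval_zero _ _⟩
  mul_mem' := by
    rintro _ _ ⟨p, rfl⟩ ⟨q, rfl⟩
    obtain ⟨r, hr⟩ := hP.exists_symEval_mul p q
    exact ⟨r, hr.symm⟩
  smul_mem' := by
    rintro z _ ⟨p, rfl⟩
    refine ⟨z • p, ?_⟩
    rw [symEval, Finsupp.sum_smul_index' fun _ => by simp, symEval, Finsupp.smul_sum]
    exact Finset.sum_congr rfl fun k _ => by simp
  star_mem' := by
    rintro _ ⟨p, rfl⟩
    refine ⟨p.sum fun k c => Finsupp.single k.swap (star c), ?_⟩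
    rw [Finsupp.sum, symEval_sum, symEval, Finsupp.sum, star_sum]
    refine Finset.sum_congr rfl fun k _ => ?_
    rw [symEval_single, star_mul, star_mul, star_pow, star_pow, star_star, map_star, mul_assoc]
    rfl

/-- The closure of the normally ordered sums is a closed *-algebra containing every (V × π)(F), a
limit of partial sums. Norm estimates on C*(π, V) thus reduce to these sums. -/
theorem cstar_le_closure_symEval (hP : P.IsIsometric) :
    (P.cstar : Set (P.H →L[ℂ] P.H)) ⊆ closure (Set.range (symEval P.π P.V)) := by
  have h : P.cstar ≤ (normallyOrdered hP).topologicalClosure := by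
    refine NonUnitalStarSubalgebra.topologicalClosure_minimal _
      (NonUnitalStarAlgebra.adjoin_le ?_) (NonUnitalStarSubalgebra.isClosed_topologicalClosure _)
    rintro _ ⟨F, rfl⟩
    exact mem_closure_of_tendsto (P.tendsto_sum_integrated F)
      (Eventually.of_forall fun K => ⟨F.partialSymbol K, P.symEval_partialSymbol F K⟩)
  exact h

/-- Two *-homomorphisms on `C*(π, V)` that agree on the range of `V × π` are equal. -/
theorem starAlgHom_ext {A : Type*} [NonUnitalCStarAlgebra A] {Φ Φ' : P.cstar →⋆ₙₐ[ℂ] A}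
    (h : ∀ F, Φ' (P.gen F) = Φ (P.gen F)) : Φ' = Φ := by
  have hle : NonUnitalStarAlgebra.adjoin ℂ (Set.range P.integrated) ≤ P.cstar :=
    NonUnitalStarSubalgebra.le_topologicalClosure _
  have hadj : ∀ Y (hY : Y ∈ NonUnitalStarAlgebra.adjoin ℂ (Set.range P.integrated)),
      Φ' ⟨Y, hle hY⟩ = Φ ⟨Y, hle hY⟩ := by
    intro Y hY
    induction hY using NonUnitalStarAlgebra.adjoin_induction with
    | mem Y hY =>
      obtain ⟨F, rfl⟩ := hY
      exact h F
    | add Y Z hY hZ h₁ h₂ =>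
      exact (map_add Φ' ⟨Y, hle hY⟩ ⟨Z, hle hZ⟩).trans
        ((congrArg₂ (· + ·) h₁ h₂).trans (map_add Φ ⟨Y, hle hY⟩ ⟨Z, hle hZ⟩).symm)
    | zero => exact (map_zero Φ').trans (map_zero Φ).symm
    | mul Y Z hY hZ h₁ h₂ =>
      exact (map_mul Φ' ⟨Y, hle hY⟩ ⟨Z, hle hZ⟩).trans
        ((congrArg₂ (· * ·) h₁ h₂).trans (map_mul Φ ⟨Y, hle hY⟩ ⟨Z, hle hZ⟩).symm)
    | smul z Y hY h₁ =>
      have e : (⟨z • Y, hle (SMulMemClass.smul_mem z hY)⟩ : P.cstar) = z • ⟨Y, hle hY⟩ := rfl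
      rw [e, map_smul, map_smul, h₁]
    | star Y hY h₁ =>
      have e : (⟨star Y, hle (star_mem hY)⟩ : P.cstar) = star ⟨Y, hle hY⟩ := Subtype.ext rfl
      rw [e, map_star Φ', map_star Φ, h₁]
  have hcont (Φ : P.cstar →⋆ₙₐ[ℂ] A) : Continuous Φ :=
    AddMonoidHomClass.continuous_of_bound Φ 1 fun Y => by
      simpa using NonUnitalStarAlgHom.norm_apply_le Φ Y
  refine DFunLike.ext _ _ fun Y => ?_
  have hY : Y ∈ closure {Y : P.cstar |
      (Y : P.H →L[ℂ] P.H) ∈ NonUnitalStarAlgebra.adjoin ℂ (Set.range P.integrated)} := by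
    rw [closure_subtype]
    refine closure_mono ?_ Y.2
    exact fun Z hZ => ⟨⟨Z, hle hZ⟩, hZ, rfl⟩
  exact closure_minimal (t := {Y | Φ' Y = Φ Y}) (fun Z hZ => hadj Z hZ)
    (isClosed_eq (hcont Φ') (hcont Φ)) hY

end LeftCovariantPair

/-! ## Direct summands of pairs -/

namespace LeftCovariantPair

universe w₁ w₂

variable {C : Type u} [CStarAlgebra C] {α : C →⋆ₐ[ℂ] C}

/-- The isometry `j` embeds the pair `Q` into `P` as a direct summand. -/
structure IsSummand (Q : LeftCovariantPair.{u, w₂} α) (P : LeftCovariantPair.{u, w₁} α)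
    (j : Q.H →L[ℂ] P.H) : Prop where
  isometry : adjoint j ∘L j = 1
  comp_V : P.V ∘L j = j ∘L Q.V
  V_comp : adjoint j ∘L P.V = Q.V ∘L adjoint j
  comp_π : ∀ c, P.π c ∘L j = j ∘L Q.π c

namespace IsSummand

variable {Q : LeftCovariantPair.{u, w₂} α} {P : LeftCovariantPair.{u, w₁} α} {j : Q.H →L[ℂ] P.H}
  (h : IsSummand Q P j)

include h

/-- The image of π is closed under adjoints, so one intertwining relation makes the range of j
reducing for it. For V alone this fails, which is why `V_comp` is a separate field. -/
theorem π_comp (c : C) : adjoint j ∘L P.π c = Q.π c ∘L adjoint j := by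
  have h' := congrArg adjoint (h.comp_π (star c))
  rwa [adjoint_comp, adjoint_comp, ← ContinuousLinearMap.star_eq_adjoint,
    ← ContinuousLinearMap.star_eq_adjoint, map_star, map_star, star_star, star_star] at h'

theorem V_pow_comp (n : ℕ) : adjoint j ∘L (P.V ^ n) = (Q.V ^ n) ∘L adjoint j := by
  induction n with
  | zero => rfl
  | succ n ih =>
    calc adjoint j ∘L (P.V ^ (n + 1)) = (adjoint j ∘L (P.V ^ n)) ∘L P.V := by rw [pow_succ]; rfl
      _ = (Q.V ^ n) ∘L (adjoint j ∘L P.V) := by rw [ih]; rfl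
      _ = (Q.V ^ (n + 1)) ∘L adjoint j := by rw [h.V_comp, pow_succ]; rfl

theorem star_V_pow_comp (n : ℕ) : (star P.V ^ n) ∘L j = j ∘L (star Q.V ^ n) := by
  have h' := congrArg adjoint (h.V_pow_comp n)
  rwa [adjoint_comp, adjoint_comp, adjoint_adjoint, ← ContinuousLinearMap.star_eq_adjoint,
    ← ContinuousLinearMap.star_eq_adjoint, star_pow, star_pow] at h'

theorem compress_symEval (p : ℕ × ℕ →₀ C) :
    adjoint j ∘L symEval P.π P.V p ∘L j = symEval Q.π Q.V p := by
  simp only [symEval, Finsupp.sum, ContinuousLinearMap.finsetSum_comp,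
    ContinuousLinearMap.comp_finsetSum]
  refine Finset.sum_congr rfl fun k _ => ?_
  calc adjoint j ∘L (P.V ^ k.1 * P.π (p k) * star P.V ^ k.2) ∘L j
      = (adjoint j ∘L (P.V ^ k.1)) ∘L P.π (p k) ∘L ((star P.V ^ k.2) ∘L j) := rfl
    _ = (Q.V ^ k.1) ∘L (adjoint j ∘L P.π (p k)) ∘L j ∘L (star Q.V ^ k.2) := by
        rw [h.V_pow_comp, h.star_V_pow_comp]; rfl
    _ = (Q.V ^ k.1) ∘L Q.π (p k) ∘L (adjoint j ∘L j) ∘L (star Q.V ^ k.2) := by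
        rw [h.π_comp]; rfl
    _ = Q.V ^ k.1 * Q.π (p k) * star Q.V ^ k.2 := by rw [h.isometry]; rfl

theorem compress_integrated (F : L1 α) :
    adjoint j ∘L P.integrated F ∘L j = Q.integrated F := by
  have hcont : Continuous fun Y : P.H →L[ℂ] P.H => adjoint j ∘L Y ∘L j :=
    continuous_const.clm_comp (continuous_id.clm_comp continuous_const)
  refine tendsto_nhds_unique ((hcont.tendsto _).comp (P.tendsto_sum_integrated F))
    ((Q.tendsto_sum_integrated F).congr fun K => ?_)
  rw [← Q.symEval_partialSymbol, ← h.compress_symEval, P.symEval_partialSymbol]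
  rfl

theorem commute_V : Commute P.V (j ∘L adjoint j) :=
  calc P.V * (j ∘L adjoint j) = (P.V ∘L j) ∘L adjoint j := rfl
    _ = j ∘L (Q.V ∘L adjoint j) := by rw [h.comp_V]; rfl
    _ = (j ∘L adjoint j) * P.V := by rw [← h.V_comp]; rfl

theorem commute_π (c : C) : Commute (P.π c) (j ∘L adjoint j) :=
  calc P.π c * (j ∘L adjoint j) = (P.π c ∘L j) ∘L adjoint j := rfl
    _ = j ∘L (Q.π c ∘L adjoint j) := by rw [h.comp_π]; rfl
    _ = (j ∘L adjoint j) * P.π c := by rw [← h.π_comp]; rfl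

theorem commute_integrated (F : L1 α) : Commute (P.integrated F) (j ∘L adjoint j) := by
  rw [integrated_apply]
  exact Commute.tsum_left _ fun n => (h.commute_V.pow_left n).mul_left (h.commute_π _)

/-- If a summand `Q` of an isometric pair `P` has the same norms as `P` on the operators
`∑ V^m π(c) V*^n`, then the compression is a *-isomorphism of the generated C*-algebras. -/
theorem exists_starAlgHom (hP : P.IsIsometric)
    (hdom : ∀ p, ‖symEval P.π P.V p‖ ≤ ‖symEval Q.π Q.V p‖) :
    ∃ Φ : P.cstar →⋆ₙₐ[ℂ] Q.cstar, (∀ F, Φ (P.gen F) = Q.gen F) ∧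
      (∀ Φ' : P.cstar →⋆ₙₐ[ℂ] Q.cstar, (∀ F, Φ' (P.gen F) = Q.gen F) → Φ' = Φ) ∧
      Function.Surjective Φ ∧ Function.Injective Φ := by
  obtain ⟨Φ, hΦ⟩ := exists_compression h.isometry (s := Set.range P.integrated) (𝓑 := Q.cstar)
    (NonUnitalStarSubalgebra.isClosed_topologicalClosure _)
    (by rintro _ ⟨F, rfl⟩; exact h.commute_integrated F)
    (by rintro _ ⟨F, rfl⟩; rw [h.compress_integrated]; exact (Q.gen F).2)
  change P.cstar →⋆ₙₐ[ℂ] Q.cstar at Φ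
  change ∀ Y : P.cstar, (Φ Y : Q.H →L[ℂ] Q.H) = adjoint j ∘L (Y : P.H →L[ℂ] P.H) ∘L j at hΦ
  have hgen (F : L1 α) : Φ (P.gen F) = Q.gen F :=
    Subtype.ext ((hΦ _).trans (h.compress_integrated F))
  have hcont : Continuous fun Y : P.H →L[ℂ] P.H => adjoint j ∘L Y ∘L j :=
    continuous_const.clm_comp (continuous_id.clm_comp continuous_const)
  -- The reverse norm inequality holds on the dense normally ordered sums by `hdom` and is a closed
  -- condition.
  have hle : ∀ Y ∈ P.cstar, ‖Y‖ ≤ ‖adjoint j ∘L Y ∘L j‖ := fun Y hY =>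
    closure_minimal (t := {Y | ‖Y‖ ≤ ‖adjoint j ∘L Y ∘L j‖})
      (by
        rintro _ ⟨p, rfl⟩
        change ‖symEval P.π P.V p‖ ≤ ‖adjoint j ∘L symEval P.π P.V p ∘L j‖
        rw [h.compress_symEval]
        exact hdom p)
      (isClosed_le continuous_norm hcont.norm) (cstar_le_closure_symEval hP hY)
  have hiso : Isometry Φ := by
    refine AddMonoidHomClass.isometry_of_norm Φ fun Y =>
      le_antisymm (NonUnitalStarAlgHom.norm_apply_le Φ Y) ((hle Y Y.2).trans_eq ?_)
    rw [← hΦ]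
    rfl
  refine ⟨Φ, hgen, fun Φ' hΦ' => starAlgHom_ext fun F => (hΦ' F).trans (hgen F).symm, ?_,
    hiso.injective⟩
  -- Surjectivity: the range of the isometric Φ is a closed *-algebra containing the generators of
  -- `Q.cstar`.
  let R : NonUnitalStarSubalgebra ℂ (Q.H →L[ℂ] Q.H) :=
    NonUnitalStarAlgHom.range ((NonUnitalStarSubalgebraClass.subtype Q.cstar).comp Φ)
  have hR : IsClosed (R : Set (Q.H →L[ℂ] Q.H)) := by
    have hi : Isometry ((NonUnitalStarSubalgebraClass.subtype Q.cstar).comp Φ) :=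
      isometry_subtype_coe.comp hiso
    exact hi.isClosedEmbedding.isClosed_range
  have hQ : Q.cstar ≤ R := by
    refine NonUnitalStarSubalgebra.topologicalClosure_minimal _
      (NonUnitalStarAlgebra.adjoin_le ?_) hR
    rintro _ ⟨F, rfl⟩
    exact ⟨P.gen F, congrArg Subtype.val (hgen F)⟩
  intro Z
  obtain ⟨Y, hY⟩ := hQ Z.2
  exact ⟨Y, Subtype.ext hY⟩

end IsSummand

end LeftCovariantPair

/-! ### The universal isometric pair and its summands -/

section Universal

variable {C : Type u} [CStarAlgebra C] {α : C →⋆ₐ[ℂ] C}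

theorem universalPair_isIsometric : (universalPair.{u, w} α).IsIsometric := by
  refine AddMonoidHomClass.isometry_of_norm (universalPair.{u, w} α).V fun x => ?_
  let y : lp (fun P : {P : LeftCovariantPair.{u, w} α // P.IsIsometric} => P.1.H) 2 := x
  have h := lp.norm_eq_tsum_rpow (p := 2) (by simp) y
  have h' := lp.norm_eq_tsum_rpow (p := 2) (by simp)
    (diagOp (fun P : {P : LeftCovariantPair.{u, w} α // P.IsIsometric} => P.1.V) zero_le_one
      (fun P => P.1.norm_V_le) y)
  refine h'.trans (Eq.trans ?_ h.symm)
  congr 2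
  funext P
  congr 1
  exact (AddMonoidHomClass.isometry_iff_norm P.1.V).1 P.2 (y P)

open Classical in
/-- Every isometric pair is a direct summand of the universal one. -/
theorem exists_isSummand_universalPair (Q : {P : LeftCovariantPair.{u, w} α // P.IsIsometric}) :
    ∃ j, LeftCovariantPair.IsSummand Q.1 (universalPair.{u, w} α) j := by
  let E := fun P : {P : LeftCovariantPair.{u, w} α // P.IsIsometric} => P.1.H
  let j : Q.1.H →L[ℂ] lp E 2 := lp.singleContinuousLinearMap ℂ E 2 Q
  -- The adjoint of the inclusion of a summand is the coordinate projection.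
  have hadj (x : lp E 2) : adjoint j x = x Q := by
    refine ext_inner_left ℂ fun y => ?_
    rw [adjoint_inner_right]
    exact lp.inner_single_left (𝕜 := ℂ) (G := E) Q y x
  have hdiag (T : ∀ P, E P →L[ℂ] E P) {K : ℝ} (hK : 0 ≤ K) (hT : ∀ P, ‖T P‖ ≤ K) :
      diagOp T hK hT ∘L j = j ∘L T Q := by
    ext y P
    change T P (lp.single 2 Q y P) = lp.single 2 Q (T Q y) P
    by_cases hP : P = Q
    · subst hP
      rw [lp.single_apply_self, lp.single_apply_self]
    · rw [lp.single_apply_ne _ _ _ hP, lp.single_apply_ne _ _ _ hP, map_zero]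
  refine ⟨j, { isometry := ?_, comp_V := ?_, V_comp := ?_, comp_π := fun c => ?_ }⟩
  · ext y
    refine (hadj (j y)).trans ?_
    exact lp.single_apply_self (E := E) 2 Q y
  · exact hdiag (fun P => P.1.V) zero_le_one fun P => P.1.norm_V_le
  · ext x
    refine (hadj _).trans ?_
    exact congrArg Q.1.V (hadj x).symm
  · exact hdiag (fun P => P.1.π c) (norm_nonneg c)
      fun P => NonUnitalStarAlgHom.norm_apply_le P.1.π c

end Universal

end Semicrossed

end

/-! ### Proof of the theorem -/

theorem mainTheorem6 {C : Type u} [CStarAlgebra C] (α : C →⋆ₐ[ℂ] C)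
    {H₀ : Type w} [NormedAddCommGroup H₀] [InnerProductSpace ℂ H₀] [CompleteSpace H₀]
    (π : C →⋆ₙₐ[ℂ] (H₀ →L[ℂ] H₀)) (hπ : Function.Injective π) :
    -- the canonical *-epimorphism `Φ : C*(π_u, V_u) → C*(π~, S)` exists, is unique, and is injective
    (∃ Φ : (Semicrossed.universalPair.{u, w} α).cstar →⋆ₙₐ[ℂ]
          (Semicrossed.shiftPair α π).cstar,
        (∀ F, Φ ((Semicrossed.universalPair.{u, w} α).gen F) =
          (Semicrossed.shiftPair α π).gen F) ∧
        (∀ Φ' : (Semicrossed.universalPair.{u, w} α).cstar →⋆ₙₐ[ℂ]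
            (Semicrossed.shiftPair α π).cstar,
          (∀ F, Φ' ((Semicrossed.universalPair.{u, w} α).gen F) =
            (Semicrossed.shiftPair α π).gen F) → Φ' = Φ) ∧
        Function.Surjective Φ ∧ Function.Injective Φ) ∧
    -- `𝔄(C, α, contr)_l ≅ 𝔄(C, α, is)_l` canonically and completely isometrically
    (∃ Θ : Semicrossed.SemicrossedContr.{u, w} α ≃ₐ[ℂ] Semicrossed.SemicrossedIsom.{u, w} α,
        (∀ F, Θ (Semicrossed.Enveloping.of _ F) = Semicrossed.Enveloping.of _ F) ∧
        ∀ (ν : ℕ) (a : Matrix (Fin ν) (Fin ν) (Semicrossed.SemicrossedContr.{u, w} α)),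
          Semicrossed.Enveloping.matrixNorm _ (a.map Θ) =
            Semicrossed.Enveloping.matrixNorm _ a) ∧
    -- `𝔄(C, α, contr)_l` is completely isometric to the closure of the polynomials `∑ Sⁿ π~(cₙ)`
    (∃ Ψ : Semicrossed.SemicrossedContr.{u, w} α →ₙₐ[ℂ] (Semicrossed.shiftPair α π).cstar,
        (∀ F, Ψ (Semicrossed.Enveloping.of _ F) = (Semicrossed.shiftPair α π).gen F) ∧
        Set.range Ψ = closure (Semicrossed.shiftPair α π).polynomials ∧
        ∀ (ν : ℕ) (a : Matrix (Fin ν) (Fin ν) (Semicrossed.SemicrossedContr.{u, w} α)),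
          ‖Semicrossed.matOp (a.map fun x => (Ψ x).1)‖ =
            Semicrossed.Enveloping.matrixNorm _ a) ∧
    -- and so is `𝔄(C, α, is)_l`
    (∃ Ψ : Semicrossed.SemicrossedIsom.{u, w} α →ₙₐ[ℂ] (Semicrossed.shiftPair α π).cstar,
        (∀ F, Ψ (Semicrossed.Enveloping.of _ F) = (Semicrossed.shiftPair α π).gen F) ∧
        Set.range Ψ = closure (Semicrossed.shiftPair α π).polynomials ∧
        ∀ (ν : ℕ) (a : Matrix (Fin ν) (Fin ν) (Semicrossed.SemicrossedIsom.{u, w} α)),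
          ‖Semicrossed.matOp (a.map fun x => (Ψ x).1)‖ =
            Semicrossed.Enveloping.matrixNorm _ a) := by
  obtain ⟨Ψ₁, hinj₁, hgen₁, hrange₁, hnorm₁⟩ := Semicrossed.exists_realization
    (𝓕 := Semicrossed.contrReps.{u, w} α) (P₀ := Semicrossed.shiftPair α π) ⟨_, rfl⟩
    (by rintro _ ⟨P, rfl⟩ ν F; exact Semicrossed.norm_matOp_integrated_le P hπ F)
  obtain ⟨Ψ₂, hinj₂, hgen₂, hrange₂, hnorm₂⟩ := Semicrossed.exists_realization
    (𝓕 := Semicrossed.isomReps.{u, w} α) (P₀ := Semicrossed.shiftPair α π)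
    ⟨_, Semicrossed.shiftPair_isIsometric α π, rfl⟩
    (by rintro _ ⟨P, -, rfl⟩ ν F; exact Semicrossed.norm_matOp_integrated_le P hπ F)
  refine ⟨?_, ?_, ⟨Ψ₁, hgen₁, hrange₁, hnorm₁⟩, ⟨Ψ₂, hgen₂, hrange₂, hnorm₂⟩⟩
  · obtain ⟨j, hj⟩ := Semicrossed.exists_isSummand_universalPair
      ⟨Semicrossed.shiftPair α π, Semicrossed.shiftPair_isIsometric α π⟩
    refine hj.exists_starAlgHom Semicrossed.universalPair_isIsometric fun p => ?_
    -- The estimate for 1 × 1 matrices, applied to the universal pair, supplies the domination that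
    -- makes Φ isometric.
    have h := Semicrossed.norm_matOp_symEval_le_shiftPair (Semicrossed.universalPair.{u, w} α) hπ
      (Matrix.of fun _ _ : Fin 1 => p)
    rwa [Semicrossed.norm_matOp_one, Semicrossed.norm_matOp_one] at h
  · have hone : Ψ₁ 1 = Ψ₂ 1 := by
      rw [← map_one (Semicrossed.Enveloping.of (Semicrossed.contrReps.{u, w} α)),
        ← map_one (Semicrossed.Enveloping.of (Semicrossed.isomReps.{u, w} α)), hgen₁, hgen₂]
    -- Θ is Ψ₂⁻¹ ∘ Ψ₁: both embeddings have the closure of the polynomials as range.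
    obtain ⟨Θ, hΘ⟩ := Semicrossed.exists_algEquiv_of_range_eq hinj₁ hinj₂
      (hrange₁.trans hrange₂.symm) hone
    refine ⟨Θ, fun F => hinj₂ (by rw [hΘ, hgen₁, hgen₂]), fun ν a => ?_⟩
    rw [← hnorm₁, ← hnorm₂, Matrix.map_map]
    simp only [Function.comp_def, hΘ]
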